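/- Let $H(n,q)$ denote the Hamming graph on the words of length $n$ over an alphabet of size $q$, two words being adjacent when they differ in exactly one position; for $q=3$ the alphabet is identified with $\mathbb{F}_3$, so that the vertex set of $H(70,3)$ is the vector space $\mathbb{F}_3^{70}$. A set $C$ of vertices of a connected graph $\Gamma$ is called a completely regular code with intersection array $\{b_0,\dots,b_{r-1};c_1,\dots,c_r\}$ if there is a partition $(P_0,\dots,P_r)$ of the vertex set into nonempty cells with $P_0=C$ and a tridiagonal matrix $(S_{ij})_{i,j=0}^{r}$ such that every vertex of $P_i$ has exactly $S_{ij}$ neighbours in $P_j$ for all $i,j$, with $S_{i,i+1}=b_i$ and $S_{i+1,i}=c_{i+1}$ for $0\le i<r$ (the partition is then the distance partition of $\Gamma$ with respect to $C$). A code in $H(70,3)$ is linear if it is a linear subspace of $\mathbb{F}_3^{70}$. Then there is no linear completely regular code in $H(70,3)$ with intersection array $\{140,126,20,1;1,10,126,140\}$, and there is no linear completely regular code in $H(70,3)$ with intersection array $\{140,126;1,30\}$. -/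

import Mathlib

/-- The Hamming graph `H(n, q)` on the words of length `n` over an alphabet `A` of size `q`:
two words are adjacent when they differ in exactly one position. -/
def hammingGraph (n : ℕ) (A : Type*) [DecidableEq A] : SimpleGraph (Fin n → A) where
  Adj x y := hammingDist x y = 1
  symm := ⟨fun x y h => by rw [hammingDist_comm]; exact h⟩
  loopless := ⟨fun x h => by simp at h⟩

/-- `(P 0, …, P r)` is a partition of the vertex set of `G` into nonempty cells, and every vertex
of `P i` has exactly `S i j` neighbours in `P j`; `S` is the intersection (quotient) matrix. -/
structure IsEquitablePartition {V : Type*} (G : SimpleGraph V) {r : ℕ}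
    (P : Fin (r + 1) → Set V) (S : Matrix (Fin (r + 1)) (Fin (r + 1)) ℕ) : Prop where
  nonempty : ∀ i, (P i).Nonempty
  existsUnique_cell : ∀ v, ∃! i, v ∈ P i
  finite_inter : ∀ v j, (G.neighborSet v ∩ P j).Finite
  ncard_inter : ∀ i j, ∀ v ∈ P i, (G.neighborSet v ∩ P j).ncard = S i j

/-- `C` is a completely regular code of covering radius `r` in the (connected) graph `G`, with
intersection array `{b 0, …, b (r-1); c 0, …, c (r-1)}` (so `c i` is what is usually written
`c_{i+1}`): `C` is the first cell of an equitable partition with tridiagonal intersection matrix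
whose superdiagonal is `b` and whose subdiagonal is `c`. In a connected graph such a partition is
necessarily the distance partition with respect to `C`. -/
def IsCompletelyRegularCode {V : Type*} (G : SimpleGraph V) (C : Set V) {r : ℕ}
    (b c : Fin r → ℕ) : Prop :=
  ∃ (P : Fin (r + 1) → Set V) (S : Matrix (Fin (r + 1)) (Fin (r + 1)) ℕ),
    P 0 = C ∧ IsEquitablePartition G P S ∧
    (∀ i j : Fin (r + 1), (i : ℕ) + 1 < j ∨ (j : ℕ) + 1 < i → S i j = 0) ∧
    (∀ i : Fin r, S i.castSucc i.succ = b i) ∧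
    (∀ i : Fin r, S i.succ i.castSucc = c i)

/-! For a linear code with the second array, the coset graph is a strongly regular Cayley graph on
𝔽₃⁶ with parameters (729, 140, 13, 30); its connection set T, the cosets of the weight-one vectors,
is a partial difference set, that is, a set of 70 points of PG(5,3) counted with both signs. For the
first array, the code together with its last cell is again linear (`exists_submodule_union`), and
merging the cells as {0,4}, {1,3}, {2} gives the same neighbour counts. So everything rests on
`not_isPartialDiffSet`.

Away from zero, the doubled character sums of T are 10 or -44, and the vectors with value -44 form a
dual set with sums of the same kind (`charSum_dualSet`). Hence each of the two sets can be counted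
through the other. Fix x in T. Exactly six lines through x carry three points of T; let D₀, …, D₅
represent their fourth points. A counting argument (`relation_ne_zero`) shows that a linear relation
between the Dᵢ modulo x involves all of them, so after sign changes their sum is a multiple of x.
The 32 dual vectors h orthogonal to x become words (Dᵢ · h) of sum zero with prescribed numbers of
zeros and coincidences, and these numbers determine the set of words up to a permutation of
coordinates (`exists_stdWords`).

The words tell, for each nonzero p in 𝔽₃⁵, how many of the three vectors Σ pᵢDᵢ + t x lie in T. If
it is one or two, the only unknown is one value in 𝔽₃: the lift, or the value that is not a lift. If
h is a dual vector orthogonal to x and x · G = 1, then at most 14 elements of T are orthogonal to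
both h and G (`card_filter_le`); so at most seven of the points p in the hyperplane of h have a lift
on the graph of a given linear functional. Subtracting a linear functional makes the unknown values
vanish at five base points, and an exhaustive search (`run_eq_true`) shows that no choice of the
remaining values respects these bounds. -/

/-! ### Real character sums over 𝔽₃ⁿ -/

/-- Twice the real part of the nontrivial additive character of `ZMod 3`. -/
def ternaryChar (a : ZMod 3) : ℤ := if a = 0 then 2 else -1

/-- For a nontrivial character χ the values are χ + χ̄, so this is the product-to-sum rule. As the
sets concerned are symmetric under negation, it lets integers replace complex numbers. -/
theorem ternaryChar_add_add_sub (a b : ZMod 3) :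
    ternaryChar (a + b) + ternaryChar (a - b) = ternaryChar a * ternaryChar b := by
  revert a b; decide

theorem ternaryChar_neg (a : ZMod 3) : ternaryChar (-a) = ternaryChar a := by
  revert a; decide

theorem sum_ternaryChar_add_mul (s t : ZMod 3) :
    ∑ a : ZMod 3, ternaryChar (s + a * t) = if t = 0 then 3 * ternaryChar s else 0 := by
  revert s t; decide

theorem ternaryChar_zero : ternaryChar 0 = 2 := rfl

section CharSum

variable {n : ℕ}

/-- The (doubled) character sum of a set of ternary vectors. -/
def charSum (S : Finset (Fin n → ZMod 3)) (h : Fin n → ZMod 3) : ℤ :=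
  ∑ w ∈ S, ternaryChar (h ⬝ᵥ w)

theorem charSum_zero (S : Finset (Fin n → ZMod 3)) : charSum S 0 = 2 * S.card := by
  simp [charSum, ternaryChar_zero, mul_comm]

theorem charSum_neg (S : Finset (Fin n → ZMod 3)) (h : Fin n → ZMod 3) :
    charSum S (-h) = charSum S h := by
  simp [charSum, ternaryChar_neg]

theorem sum_univ_ternaryChar_dotProduct {v : Fin n → ZMod 3} (hv : v ≠ 0) :
    ∑ h : Fin n → ZMod 3, ternaryChar (h ⬝ᵥ v) = 0 := by
  obtain ⟨i, hi⟩ := Function.ne_iff.mp hv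
  -- Translating h along a coordinate where v does not vanish averages the character over 𝔽₃, which
  -- gives zero.
  have shift : ∀ a : ZMod 3, ∑ h : Fin n → ZMod 3, ternaryChar (h ⬝ᵥ v)
      = ∑ h : Fin n → ZMod 3, ternaryChar (h ⬝ᵥ v + a * v i) := by
    intro a
    rw [← Equiv.sum_comp (Equiv.addRight (Pi.single i a)) fun h => ternaryChar (h ⬝ᵥ v)]
    simp [add_dotProduct]
  have h3 : (3 : ℤ) * ∑ h : Fin n → ZMod 3, ternaryChar (h ⬝ᵥ v) = 0 := by
    calc (3 : ℤ) * ∑ h : Fin n → ZMod 3, ternaryChar (h ⬝ᵥ v)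
        = ∑ a : ZMod 3, ∑ h : Fin n → ZMod 3, ternaryChar (h ⬝ᵥ v + a * v i) := by
          rw [Finset.sum_congr rfl fun a _ => (shift a).symm]; simp [ZMod.card]
      _ = 0 := by
          rw [Finset.sum_comm]
          refine Finset.sum_eq_zero fun h _ => ?_
          rw [sum_ternaryChar_add_mul, if_neg (by simpa using hi)]
  omega

theorem sum_univ_ternaryChar_dotProduct_mul (w v : Fin n → ZMod 3) :
    ∑ h : Fin n → ZMod 3, ternaryChar (h ⬝ᵥ w) * ternaryChar (h ⬝ᵥ v)
      = (if w + v = 0 then 2 * 3 ^ n else 0) + (if w - v = 0 then 2 * 3 ^ n else 0) := by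
  have key : ∀ u : Fin n → ZMod 3, ∑ h : Fin n → ZMod 3, ternaryChar (h ⬝ᵥ u)
      = if u = 0 then 2 * 3 ^ n else 0 := by
    intro u
    split_ifs with hu
    · subst hu; simp [ternaryChar_zero, ZMod.card, mul_comm]
    · exact sum_univ_ternaryChar_dotProduct hu
  rw [← key, ← key, ← Finset.sum_add_distrib]
  refine Finset.sum_congr rfl fun h _ => ?_
  rw [dotProduct_add, dotProduct_sub, ternaryChar_add_add_sub]

/-- Orthogonality relation for the subspace spanned by two vectors. -/
theorem sum_charSum_span_pair (S : Finset (Fin n → ZMod 3)) (u v : Fin n → ZMod 3) :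
    ∑ a : ZMod 3, ∑ b : ZMod 3, charSum S (a • u + b • v)
      = 18 * (S.filter fun h => u ⬝ᵥ h = 0 ∧ v ⬝ᵥ h = 0).card := by
  have : ∀ h : Fin n → ZMod 3, ∑ a : ZMod 3, ∑ b : ZMod 3, ternaryChar ((a • u + b • v) ⬝ᵥ h)
      = if u ⬝ᵥ h = 0 ∧ v ⬝ᵥ h = 0 then 18 else 0 := by
    intro h
    simp only [add_dotProduct, smul_dotProduct, smul_eq_mul]
    generalize u ⬝ᵥ h = s; generalize v ⬝ᵥ h = t
    revert s t; decide
  simp only [charSum]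
  rw [Finset.sum_congr rfl fun a _ => Finset.sum_comm, Finset.sum_comm,
    Finset.sum_congr rfl fun h _ => this h, ← Finset.sum_filter]
  simp [mul_comm]

/-- Orthogonality relation for the subspace spanned by three vectors. -/
theorem sum_charSum_span_triple (S : Finset (Fin n → ZMod 3)) (u v w : Fin n → ZMod 3) :
    ∑ c : ZMod 3 × ZMod 3 × ZMod 3, charSum S (c.1 • u + c.2.1 • v + c.2.2 • w)
      = 54 * (S.filter fun h => u ⬝ᵥ h = 0 ∧ v ⬝ᵥ h = 0 ∧ w ⬝ᵥ h = 0).card := by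
  have : ∀ h : Fin n → ZMod 3, ∑ c : ZMod 3 × ZMod 3 × ZMod 3,
      ternaryChar ((c.1 • u + c.2.1 • v + c.2.2 • w) ⬝ᵥ h)
      = if u ⬝ᵥ h = 0 ∧ v ⬝ᵥ h = 0 ∧ w ⬝ᵥ h = 0 then 54 else 0 := by
    intro h
    simp only [add_dotProduct, smul_dotProduct, smul_eq_mul]
    generalize u ⬝ᵥ h = r; generalize v ⬝ᵥ h = s; generalize w ⬝ᵥ h = t
    revert r s t; decide
  simp only [charSum]
  rw [Finset.sum_comm, Finset.sum_congr rfl fun h _ => this h, ← Finset.sum_filter]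
  simp [mul_comm]

theorem charSum_eq_card (S : Finset (Fin n → ZMod 3)) (v : Fin n → ZMod 3) :
    charSum S v = 3 * (S.filter fun h => v ⬝ᵥ h = 0).card - S.card := by
  have : ∀ h : Fin n → ZMod 3, ternaryChar (v ⬝ᵥ h) = 3 * (if v ⬝ᵥ h = 0 then 1 else 0) - 1 := by
    intro h; generalize v ⬝ᵥ h = t; revert t; decide
  simp only [charSum, this, Finset.sum_sub_distrib, ← Finset.mul_sum]
  simp

end CharSum

/-! ### Partial difference sets and their duals -/

/-- A set `T` of `140` vectors that is a partial difference set in `𝔽₃⁶` with parameters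
`(729, 140, 13, 30)`. -/
structure IsPartialDiffSet (T : Finset (Fin 6 → ZMod 3)) : Prop where
  card_eq : T.card = 140
  neg_mem : ∀ w ∈ T, -w ∈ T
  zero_notMem : 0 ∉ T
  count_mem : ∀ v ∈ T, (T.filter fun w => v - w ∈ T).card = 13
  count_notMem : ∀ v ∉ T, v ≠ 0 → (T.filter fun w => v - w ∈ T).card = 30

/-- The vectors at which the character sum of `T` takes its smaller value. -/
def dualSet (T : Finset (Fin 6 → ZMod 3)) : Finset (Fin 6 → ZMod 3) :=
  Finset.univ.filter fun h => h ≠ 0 ∧ charSum T h = -44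

namespace IsPartialDiffSet

variable {T : Finset (Fin 6 → ZMod 3)}

theorem neg_mem_iff (hT : IsPartialDiffSet T) {w : Fin 6 → ZMod 3} : -w ∈ T ↔ w ∈ T :=
  ⟨fun h => by simpa using hT.neg_mem _ h, hT.neg_mem w⟩

theorem ne_zero (hT : IsPartialDiffSet T) {w : Fin 6 → ZMod 3} (hw : w ∈ T) : w ≠ 0 :=
  fun h => hT.zero_notMem (h ▸ hw)

/-- The square of the sum c counts each v with the number of its representations as a sum of two
elements of `T`. Inserting 140, 13 and 30 gives c² = 440 - 34c, that is, (c - 10)(c + 44) = 0. -/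
theorem charSum_eq_or (hT : IsPartialDiffSet T) {h : Fin 6 → ZMod 3} (hh : h ≠ 0) :
    charSum T h = 10 ∨ charSum T h = -44 := by
  set c := charSum T h with hc
  set S := ∑ w ∈ T, ∑ w' ∈ T, ternaryChar (h ⬝ᵥ (w + w')) with hS
  have h1 : 2 * S = c * c := by
    have inner : ∀ w, 2 * ∑ w' ∈ T, ternaryChar (h ⬝ᵥ (w + w')) = ternaryChar (h ⬝ᵥ w) * c := by
      intro w
      have hn : ∑ w' ∈ T, ternaryChar (h ⬝ᵥ (w + w')) = ∑ w' ∈ T, ternaryChar (h ⬝ᵥ (w - w')) := by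
        refine Finset.sum_nbij' (fun w => -w) (fun w => -w) ?_ ?_ ?_ ?_ ?_
        · exact fun a ha => hT.neg_mem a ha
        · exact fun a ha => hT.neg_mem a ha
        · simp
        · simp
        · intro a _; simp
      rw [two_mul]
      nth_rewrite 2 [hn]
      rw [← Finset.sum_add_distrib, hc, charSum, Finset.mul_sum]
      refine Finset.sum_congr rfl fun w' _ => ?_
      rw [dotProduct_add, dotProduct_sub, ternaryChar_add_add_sub]
    rw [hS, Finset.mul_sum, Finset.sum_congr rfl fun w _ => inner w, ← Finset.sum_mul]
    rfl
  have h2 : S = ∑ v, ((T.filter fun w => v - w ∈ T).card : ℤ) * ternaryChar (h ⬝ᵥ v) := by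
    have : ∀ w ∈ T, ∑ w' ∈ T, ternaryChar (h ⬝ᵥ (w + w'))
        = ∑ v, if v - w ∈ T then ternaryChar (h ⬝ᵥ v) else 0 := by
      intro w _
      rw [← Equiv.sum_comp (Equiv.addLeft w) fun v => if v - w ∈ T then ternaryChar (h ⬝ᵥ v) else 0]
      simp
    rw [hS, Finset.sum_congr rfl this, Finset.sum_comm]
    refine Finset.sum_congr rfl fun v _ => ?_
    rw [← Finset.sum_filter]; simp
  have h3 : ∀ v : Fin 6 → ZMod 3, ((T.filter fun w => v - w ∈ T).card : ℤ)
      = 30 - 17 * (if v ∈ T then 1 else 0) + 110 * (if v = 0 then 1 else 0) := by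
    intro v
    by_cases hv : v = 0
    · subst hv
      have : (T.filter fun w => 0 - w ∈ T) = T :=
        Finset.filter_true_of_mem fun w hw => by simpa using hT.neg_mem w hw
      rw [this, hT.card_eq, if_neg hT.zero_notMem]; norm_num
    · by_cases hvT : v ∈ T
      · rw [hT.count_mem v hvT]; simp [hv, hvT]
      · rw [hT.count_notMem v hvT hv]; simp [hv, hvT]
  have h4 : S = 220 - 17 * c := by
    have e0 : ∑ v : Fin 6 → ZMod 3, ternaryChar (h ⬝ᵥ v) = 0 := by
      rw [← sum_univ_ternaryChar_dotProduct hh]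
      exact Finset.sum_congr rfl fun v _ => by rw [dotProduct_comm]
    have e1 : ∑ v : Fin 6 → ZMod 3, (if v ∈ T then 1 else 0) * ternaryChar (h ⬝ᵥ v) = c := by
      simp only [ite_mul, one_mul, zero_mul, ← Finset.sum_filter]
      simp [hc, charSum]
    have e2 : ∑ v : Fin 6 → ZMod 3, (if v = 0 then 1 else 0) * ternaryChar (h ⬝ᵥ v) = 2 := by
      simp [ternaryChar_zero]
    rw [h2, Finset.sum_congr rfl fun v _ => by rw [h3 v, add_mul, sub_mul, mul_assoc, mul_assoc],
      Finset.sum_add_distrib, Finset.sum_sub_distrib, ← Finset.mul_sum, ← Finset.mul_sum,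
      ← Finset.mul_sum, e0, e1, e2]
    ring
  have h5 : (c - 10) * (c + 44) = 0 := by linear_combination h1 * (-1) + 2 * h4
  rcases mul_eq_zero.mp h5 with h | h
  · left; omega
  · right; omega

theorem charSum_eq (hT : IsPartialDiffSet T) (h : Fin 6 → ZMod 3) :
    charSum T h = 10 - 54 * (if h ∈ dualSet T then 1 else 0) + 270 * (if h = 0 then 1 else 0) := by
  by_cases hh : h = 0
  · subst hh
    rw [charSum_zero, hT.card_eq]; simp [dualSet]
  · rcases hT.charSum_eq_or hh with h' | h'
    · simp [dualSet, hh, h']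
    · simp [dualSet, hh, h']

/-- Fourier inversion: up to a constant and a term at zero, `charSum T` is -54 times the indicator
of the dual set, so transforming once more recovers the indicator of `T`. -/
theorem charSum_dualSet (hT : IsPartialDiffSet T) (v : Fin 6 → ZMod 3) :
    charSum (dualSet T) v
      = 10 - 54 * (if v ∈ T then 1 else 0) + 270 * (if v = 0 then 1 else 0) := by
  have e1 : ∑ h : Fin 6 → ZMod 3, charSum T h * ternaryChar (h ⬝ᵥ v)
      = ∑ w ∈ T, ((if w + v = 0 then 2 * 3 ^ 6 else 0) + (if w - v = 0 then 2 * 3 ^ 6 else 0)) := by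
    simp only [charSum, Finset.sum_mul]
    rw [Finset.sum_comm]
    exact Finset.sum_congr rfl fun w _ => sum_univ_ternaryChar_dotProduct_mul w v
  have e2 : ∑ w ∈ T, (((if w + v = 0 then 2 * 3 ^ 6 else 0) : ℤ) + (if w - v = 0 then 2 * 3 ^ 6 else 0))
      = 4 * 3 ^ 6 * (if v ∈ T then 1 else 0) := by
    rw [Finset.sum_add_distrib]
    simp only [add_eq_zero_iff_eq_neg, sub_eq_zero, Finset.sum_ite_eq', hT.neg_mem_iff]
    split_ifs <;> norm_num
  have e3 : ∑ h : Fin 6 → ZMod 3, charSum T h * ternaryChar (h ⬝ᵥ v)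
      = 10 * (if v = 0 then 2 * 3 ^ 6 else 0) - 54 * charSum (dualSet T) v + 540 := by
    have k0 : ∑ h : Fin 6 → ZMod 3, ternaryChar (h ⬝ᵥ v) = if v = 0 then 2 * 3 ^ 6 else 0 := by
      split_ifs with hv
      · subst hv; simp [ternaryChar_zero, ZMod.card]
      · exact sum_univ_ternaryChar_dotProduct hv
    have k1 : ∑ h : Fin 6 → ZMod 3, (if h ∈ dualSet T then 1 else 0) * ternaryChar (h ⬝ᵥ v)
        = charSum (dualSet T) v := by
      simp only [ite_mul, one_mul, zero_mul, ← Finset.sum_filter, charSum]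
      simp [dotProduct_comm]
    have k2 : ∑ h : Fin 6 → ZMod 3, (if h = 0 then 1 else 0) * ternaryChar (h ⬝ᵥ v) = 2 := by
      simp [ternaryChar_zero]
    rw [Finset.sum_congr rfl fun h _ => by
      rw [hT.charSum_eq h, add_mul, sub_mul, mul_assoc, mul_assoc],
      Finset.sum_add_distrib, Finset.sum_sub_distrib, ← Finset.mul_sum, ← Finset.mul_sum,
      ← Finset.mul_sum, k0, k1, k2]
    ring
  rw [e1, e2] at e3
  split_ifs at e3 ⊢ <;> omega

theorem card_dualSet (hT : IsPartialDiffSet T) : (dualSet T).card = 140 := by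
  have := hT.charSum_dualSet 0
  rw [charSum_zero] at this
  simp [hT.zero_notMem] at this
  omega

end IsPartialDiffSet

theorem neg_mem_dualSet {T : Finset (Fin 6 → ZMod 3)} {h : Fin 6 → ZMod 3}
    (hh : h ∈ dualSet T) : -h ∈ dualSet T := by
  simp only [dualSet, Finset.mem_filter, Finset.mem_univ, true_and] at hh ⊢
  exact ⟨neg_ne_zero.mpr hh.1, by rw [charSum_neg]; exact hh.2⟩

/-! ### Representatives up to sign, and fibre counts over 𝔽₃ -/

theorem ZMod.sum_three {M : Type*} [AddCommMonoid M] (f : ZMod 3 → M) :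
    ∑ a, f a = f 0 + f 1 + f 2 := Fin.sum_univ_three f

theorem ZMod.three_cases (a : ZMod 3) : a = 0 ∨ a = 1 ∨ a = -1 := by
  revert a; decide

theorem ZMod.two_eq_neg_one_three : (2 : ZMod 3) = -1 := by decide

/-- Representatives of the pairs `±v` in a symmetric set of nonzero vectors. -/
theorem exists_neg_representatives {n : ℕ} (k : ℕ) : ∀ S : Finset (Fin n → ZMod 3),
    (∀ v ∈ S, -v ∈ S) → 0 ∉ S → S.card = 2 * k →
    ∃ D : Fin k → Fin n → ZMod 3, (∀ i, D i ∈ S) ∧ ∀ i j, i ≠ j → D i ≠ D j ∧ D i ≠ -D j := by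
  induction k with
  | zero => exact fun S _ _ _ => ⟨Fin.elim0, fun i => i.elim0, fun i => i.elim0⟩
  | succ k ih =>
    intro S hneg h0 hcard
    obtain ⟨v, hv⟩ : S.Nonempty := Finset.card_pos.mp (by omega)
    have hvn : -v ≠ v := by
      intro h
      apply h0
      have : v = 0 := by
        funext i
        have := congrFun h i
        simp only [Pi.neg_apply] at this
        have key : ∀ a : ZMod 3, -a = a → a = 0 := by decide
        exact key _ this
      exact this ▸ hv
    have hv' : -v ∈ S.erase v := Finset.mem_erase.mpr ⟨hvn, hneg v hv⟩
    obtain ⟨D, hD, hDne⟩ := ih ((S.erase v).erase (-v)) (by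
        intro w hw
        simp only [Finset.mem_erase] at hw ⊢
        refine ⟨fun h => hw.2.1 (neg_injective h), fun h => hw.1 (by rw [← h, neg_neg]), hneg w hw.2.2⟩)
      (by simp [h0])
      (by rw [Finset.card_erase_of_mem hv', Finset.card_erase_of_mem hv]; omega)
    have hD' : ∀ i, D i ≠ v ∧ D i ≠ -v ∧ D i ∈ S := by
      intro i
      have := hD i
      simp only [Finset.mem_erase] at this
      exact ⟨this.2.1, this.1, this.2.2⟩
    refine ⟨Fin.cons v D, ?_, ?_⟩
    · intro i
      refine Fin.cases ?_ (fun i => ?_) i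
      · simpa using hv
      · simpa using (hD' i).2.2
    · intro i j
      refine Fin.cases ?_ (fun i => ?_) i <;> refine Fin.cases ?_ (fun j => ?_) j
      · exact fun h => absurd rfl h
      · intro _
        simp only [Fin.cons_zero, Fin.cons_succ]
        exact ⟨(hD' j).1.symm, fun h => (hD' j).2.1 (by rw [h, neg_neg])⟩
      · intro _
        simp only [Fin.cons_zero, Fin.cons_succ]
        exact ⟨(hD' i).1, (hD' i).2.1⟩
      · intro h
        simp only [Fin.cons_succ]
        exact hDne i j fun h' => h (by rw [h'])

section Fiber

variable {ι : Type*}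

theorem sum_sum_ite_eq_fiber (S : Finset ι) (y : ι → ZMod 3) :
    ∑ i ∈ S, ∑ j ∈ S, (if y i = y j then 1 else 0)
      = (S.filter (y · = 0)).card ^ 2 + (S.filter (y · = 1)).card ^ 2
        + (S.filter (y · = 2)).card ^ 2 := by
  have h1 : ∀ i, ∑ j ∈ S, (if y i = y j then 1 else 0) = (S.filter (y · = y i)).card := by
    intro i; rw [Finset.card_filter]
    exact Finset.sum_congr rfl fun j _ => by simp [eq_comm]
  simp only [h1]
  rw [← Finset.sum_fiberwise S y, ZMod.sum_three]
  have h2 : ∀ r, ∑ i ∈ S with y i = r, (S.filter (y · = y i)).card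
      = (S.filter (y · = r)).card ^ 2 := by
    intro r
    rw [Finset.sum_congr rfl (g := fun _ => (S.filter (y · = r)).card)]
    · simp [sq]
    · intro i hi; rw [(Finset.mem_filter.mp hi).2]
  rw [h2, h2, h2]

theorem card_eq_add_fiber (S : Finset ι) (y : ι → ZMod 3) :
    S.card = (S.filter (y · = 0)).card + (S.filter (y · = 1)).card
        + (S.filter (y · = 2)).card := by
  simpa [ZMod.sum_three] using
    Finset.card_eq_sum_card_fiberwise (f := y) (s := S) (t := Finset.univ) (by simp [Set.MapsTo])

theorem sum_eq_fiber (S : Finset ι) (y : ι → ZMod 3) :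
    ∑ i ∈ S, y i = (((S.filter (y · = 1)).card + 2 * (S.filter (y · = 2)).card : ℕ) : ZMod 3) := by
  rw [← Finset.sum_fiberwise S y, ZMod.sum_three]
  have h2 : ∀ r, ∑ i ∈ S with y i = r, y i = ((S.filter (y · = r)).card : ZMod 3) * r := by
    intro r
    rw [Finset.sum_congr rfl (g := fun _ => r)]
    · simp
    · intro i hi; exact (Finset.mem_filter.mp hi).2
  rw [h2, h2, h2]; push_cast; ring

end Fiber

/-! ### Lines and planes through a point of T -/

namespace IsPartialDiffSet

variable {T : Finset (Fin 6 → ZMod 3)} {x : Fin 6 → ZMod 3}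

/-- The number of `t` with `v + t x ∈ T` is determined by the dual set. -/
theorem card_dualSet_filter_add (hT : IsPartialDiffSet T) (hx : x ∈ T) {v : Fin 6 → ZMod 3}
    (hv : ∀ t : ZMod 3, v + t • x ≠ 0) :
    ((dualSet T).filter fun h => x ⬝ᵥ h = 0 ∧ v ⬝ᵥ h = 0).card
      + 6 * (Finset.univ.filter fun t : ZMod 3 => v + t • x ∈ T).card = 14 := by
  -- Of the nine combinations, zero contributes 280, `±x` contribute -44 each, and the other six are
  -- the pairs `±(v + t • x)`, each vector of value 10 or -44. So 18 times the dual count is 252 -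
  -- 108 · #{t}.
  have key := sum_charSum_span_pair (dualSet T) x v
  have e0 : charSum (dualSet T) 0 = 280 := by rw [charSum_zero, hT.card_dualSet]; norm_num
  have e1 : charSum (dualSet T) x = -44 := by
    rw [hT.charSum_dualSet, if_pos hx, if_neg (hT.ne_zero hx)]; norm_num
  have e2 : ∀ t : ZMod 3, charSum (dualSet T) (v + t • x)
      = 10 - 54 * (if v + t • x ∈ T then 1 else 0) := by
    intro t; rw [hT.charSum_dualSet, if_neg (hv t)]; norm_num
  have e3 : ∀ a b : ZMod 3, charSum (dualSet T) (a • x + b • v)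
      = if b = 0 then (if a = 0 then 280 else -44)
        else 10 - 54 * (if v + (a * b) • x ∈ T then 1 else 0) := by
    intro a b
    rcases ZMod.three_cases b with rfl | rfl | rfl
    · rcases ZMod.three_cases a with rfl | rfl | rfl
      · simpa using e0
      · simpa using e1
      · simpa [charSum_neg] using e1
    · rw [if_neg (by decide), ← e2]; simp [add_comm]
    · rw [if_neg (by decide), ← e2, ← charSum_neg]; simp
  simp only [e3] at key
  rw [Finset.card_filter fun t : ZMod 3 => v + t • x ∈ T]
  simp only [ZMod.sum_three] at key ⊢
  have r1 : ((1 : ZMod 3) = 0) = False := by simp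
  have r2 : ((2 : ZMod 3) = 0) = False := by simp; decide
  have r3 : (2 : ZMod 3) * 2 = 1 := by decide
  simp only [r1, r2, r3, if_true, if_false, mul_one, one_mul, zero_mul] at key
  zify
  split_ifs at key ⊢ <;> omega

/-- `D` is the fourth point of a line through `x` whose other three points lie in `T`. -/
def IsHole (T : Finset (Fin 6 → ZMod 3)) (x D : Fin 6 → ZMod 3) : Prop :=
  D ≠ 0 ∧ D + x ∈ T ∧ D - x ∈ T

theorem IsHole.neg (hT : IsPartialDiffSet T) {D : Fin 6 → ZMod 3} (hD : IsHole T x D) :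
    IsHole T x (-D) := by
  refine ⟨neg_ne_zero.mpr hD.1, ?_, ?_⟩
  · rw [← hT.neg_mem_iff]; convert hD.2.2 using 1; abel
  · rw [← hT.neg_mem_iff]; convert hD.2.1 using 1; abel

theorem IsHole.add_smul_ne_zero (hT : IsPartialDiffSet T) {D : Fin 6 → ZMod 3}
    (hD : IsHole T x D) (t : ZMod 3) : D + t • x ≠ 0 := by
  rcases ZMod.three_cases t with rfl | rfl | rfl
  · simpa using hD.1
  · simpa using hT.ne_zero hD.2.1
  · simpa [sub_eq_add_neg] using hT.ne_zero hD.2.2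

theorem IsHole.notMem_and_card (hT : IsPartialDiffSet T) (hx : x ∈ T) {D : Fin 6 → ZMod 3}
    (hD : IsHole T x D) : D ∉ T ∧
      ((dualSet T).filter fun h => x ⬝ᵥ h = 0 ∧ D ⬝ᵥ h = 0).card = 2 := by
  have key := hT.card_dualSet_filter_add hx (hD.add_smul_ne_zero hT)
  rw [Finset.card_filter fun t : ZMod 3 => D + t • x ∈ T, ZMod.sum_three] at key
  have h1 : D + (1 : ZMod 3) • x ∈ T := by simpa using hD.2.1
  have h2 : D + (2 : ZMod 3) • x ∈ T := by
    rw [ZMod.two_eq_neg_one_three]; simpa [sub_eq_add_neg] using hD.2.2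
  rw [if_pos h1, if_pos h2] at key
  by_cases h0 : D ∈ T
  · rw [if_pos (by simpa using h0)] at key; omega
  · rw [if_neg (by simpa using h0)] at key; exact ⟨h0, by omega⟩

/-- Orthogonality over the 27 combinations of `x`, `D`, `E` shows that the number of them in `T`
plus the number of dual vectors orthogonal to all three is 10. The two lines through `x` already
supply ten: `±x`, `±D ± x`, `±E ± x`. So there are no others, and no such dual vector. -/
theorem IsHole.pair (hT : IsPartialDiffSet T) (hx : x ∈ T) {D E : Fin 6 → ZMod 3}
    (hD : IsHole T x D) (hE : IsHole T x E) (h1 : D ≠ E) (h2 : D ≠ -E) :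
    (∀ a b c : ZMod 3, b ≠ 0 → c ≠ 0 → b • D + c • E + a • x ∉ insert 0 T) ∧
      ∀ h ∈ dualSet T, x ⬝ᵥ h = 0 → D ⬝ᵥ h = 0 → E ⬝ᵥ h ≠ 0 := by
  have hDT := (hD.notMem_and_card hT hx).1
  -- independence
  have indep : ∀ t : ZMod 3, D + t • x ≠ E := by
    intro t
    rcases ZMod.three_cases t with rfl | rfl | rfl
    · simpa using h1
    · intro h; exact (hE.notMem_and_card hT hx).1 (by rw [← h]; simpa using hD.2.1)
    · intro h
      exact (hE.notMem_and_card hT hx).1 (by rw [← h]; simpa [sub_eq_add_neg] using hD.2.2)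
  have indep' : ∀ t : ZMod 3, D + t • x ≠ -E := by
    intro t
    have hE' := hE.neg hT
    rcases ZMod.three_cases t with rfl | rfl | rfl
    · simpa using h2
    · intro h; exact (hE'.notMem_and_card hT hx).1 (by rw [← h]; simpa using hD.2.1)
    · intro h
      exact (hE'.notMem_and_card hT hx).1 (by rw [← h]; simpa [sub_eq_add_neg] using hD.2.2)
  have ne0 : ∀ c : ZMod 3 × ZMod 3 × ZMod 3, c ≠ 0 →
      c.1 • x + c.2.1 • D + c.2.2 • E ≠ 0 := by
    rintro ⟨a, b, c⟩ hc h
    simp only at h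
    rcases ZMod.three_cases c with rfl | rfl | rfl
    · rcases ZMod.three_cases b with rfl | rfl | rfl
      · rcases ZMod.three_cases a with rfl | rfl | rfl
        · exact hc rfl
        · exact hT.ne_zero hx (by simpa using h)
        · exact hT.ne_zero hx (by simpa using h)
      · exact hD.add_smul_ne_zero hT a (by simpa [add_comm] using h)
      · exact (hD.neg hT).add_smul_ne_zero hT a (by simpa [add_comm] using h)
    · rcases ZMod.three_cases b with rfl | rfl | rfl
      · exact hE.add_smul_ne_zero hT a (by simpa [add_comm] using h)
      · exact indep' a (eq_neg_of_add_eq_zero_left (by rw [← h]; module))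
      · refine indep (-a) (sub_eq_zero.mp ?_)
        rw [← neg_eq_zero, ← h]; module
    · rcases ZMod.three_cases b with rfl | rfl | rfl
      · exact (hE.neg hT).add_smul_ne_zero hT a (by simpa [add_comm] using h)
      · refine indep a (sub_eq_zero.mp ?_)
        rw [← h]; module
      · refine indep' (-a) (eq_neg_of_add_eq_zero_left ?_)
        rw [← neg_eq_zero, ← h]; module
  have key := sum_charSum_span_triple (dualSet T) x D E
  have val : ∀ c : ZMod 3 × ZMod 3 × ZMod 3,
      charSum (dualSet T) (c.1 • x + c.2.1 • D + c.2.2 • E)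
        = 10 - 54 * (if c.1 • x + c.2.1 • D + c.2.2 • E ∈ T then 1 else 0)
          + 270 * (if c = 0 then 1 else 0) := by
    intro c
    rw [hT.charSum_dualSet]
    by_cases hc : c = 0
    · subst hc; simp
    · rw [if_neg (ne0 c hc), if_neg hc]
  set F := Finset.univ.filter fun c : ZMod 3 × ZMod 3 × ZMod 3 =>
    c.1 • x + c.2.1 • D + c.2.2 • E ∈ T with hF
  have cF : (54 : ℤ) * ((dualSet T).filter fun h =>
      x ⬝ᵥ h = 0 ∧ D ⬝ᵥ h = 0 ∧ E ⬝ᵥ h = 0).card = 540 - 54 * F.card := by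
    rw [← key, Finset.sum_congr rfl fun c _ => val c, Finset.sum_add_distrib,
      Finset.sum_sub_distrib, ← Finset.mul_sum, ← Finset.mul_sum, hF, Finset.card_filter]
    simp [ZMod.card]
    ring
  -- The coefficients of the ten combinations known to lie in `T`.
  set K := Finset.univ.filter fun c : ZMod 3 × ZMod 3 × ZMod 3 =>
    c.1 ≠ 0 ∧ (c.2.1 = 0 ∨ c.2.2 = 0) with hK
  have cK : K.card = 10 := by rw [hK]; decide
  have hKF : K ⊆ F := by
    have line : ∀ {G : Fin 6 → ZMod 3}, IsHole T x G → ∀ a b : ZMod 3, a ≠ 0 →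
        a • x + b • G ∈ T := by
      intro G hG a b ha
      rcases ZMod.three_cases a with rfl | rfl | rfl
      · exact absurd rfl ha
      · rcases ZMod.three_cases b with rfl | rfl | rfl
        · simpa using hx
        · simpa [add_comm] using hG.2.1
        · simpa [add_comm] using (hG.neg hT).2.1
      · rcases ZMod.three_cases b with rfl | rfl | rfl
        · simpa using hT.neg_mem x hx
        · simpa [add_comm, sub_eq_add_neg] using hG.2.2
        · simpa [add_comm, sub_eq_add_neg] using (hG.neg hT).2.2
    rintro ⟨a, b, c⟩ hc
    simp only [hK, hF, Finset.mem_filter, Finset.mem_univ, true_and] at hc ⊢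
    rcases hc with ⟨ha, rfl | rfl⟩
    · simpa using line hE a c ha
    · simpa using line hD a b ha
  have hle : F.card ≤ 10 := by
    have := Nat.cast_nonneg (α := ℤ) ((dualSet T).filter fun h =>
      x ⬝ᵥ h = 0 ∧ D ⬝ᵥ h = 0 ∧ E ⬝ᵥ h = 0).card
    omega
  have hKF' : K = F := Finset.eq_of_subset_of_card_le hKF (by omega)
  constructor
  · intro a b c hb hc hmem
    have e : b • D + c • E + a • x = a • x + b • D + c • E := by abel
    rw [e] at hmem
    rcases Finset.mem_insert.mp hmem with h | h
    · exact ne0 (a, b, c) (by simp [hb]) h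
    · have : (a, b, c) ∈ K := by rw [hKF']; simp [hF, h]
      simp [hK, hb, hc] at this
  · intro h hh e1 e2 e3
    have : ((dualSet T).filter fun h => x ⬝ᵥ h = 0 ∧ D ⬝ᵥ h = 0 ∧ E ⬝ᵥ h = 0).card = 0 := by
      rw [← hKF', cK] at cF
      omega
    have hmem : h ∈ (dualSet T).filter fun h => x ⬝ᵥ h = 0 ∧ D ⬝ᵥ h = 0 ∧ E ⬝ᵥ h = 0 :=
      Finset.mem_filter.mpr ⟨hh, e1, e2, e3⟩
    rw [Finset.card_eq_zero] at this
    rw [this] at hmem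
    exact absurd hmem (Finset.notMem_empty _)

/-- Since `3 • x = 0`, the map D ↦ D - x matches the D with D ± x in `T` with the 13 representations
of `x` as a sum of two elements of `T`; D = 0 stands for x = -x + -x and is discarded. -/
theorem card_holes (hT : IsPartialDiffSet T) (hx : x ∈ T) :
    (Finset.univ.filter fun D : Fin 6 → ZMod 3 => D ≠ 0 ∧ D + x ∈ T ∧ D - x ∈ T).card = 12 := by
  have h0 : (0 : Fin 6 → ZMod 3) ∈
      Finset.univ.filter fun D : Fin 6 → ZMod 3 => D + x ∈ T ∧ D - x ∈ T := by
    simp [hx, hT.neg_mem x hx]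
  have h13 : (Finset.univ.filter fun D : Fin 6 → ZMod 3 => D + x ∈ T ∧ D - x ∈ T).card = 13 := by
    rw [← hT.count_mem x hx]
    refine Finset.card_nbij' (fun D => D - x) (fun w => w + x) ?_ ?_ ?_ ?_
    · intro D hD
      simp only [Finset.coe_filter, Finset.mem_univ, true_and, Set.mem_ofPred_eq] at hD ⊢
      refine ⟨hD.2, ?_⟩
      rw [← hT.neg_mem_iff]
      convert hD.1 using 1
      have : (3 : ZMod 3) = 0 := by decide
      have e : (3 : ZMod 3) • x = 0 := by rw [this, zero_smul]
      calc -(x - (D - x)) = D + x - (3 : ZMod 3) • x := by module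
        _ = D + x := by rw [e, sub_zero]
    · intro w hw
      simp only [Finset.coe_filter, Finset.mem_univ, true_and, Set.mem_ofPred_eq] at hw ⊢
      refine ⟨?_, by simpa using hw.1⟩
      rw [← hT.neg_mem_iff]
      convert hw.2 using 1
      have : (3 : ZMod 3) = 0 := by decide
      have e : (3 : ZMod 3) • x = 0 := by rw [this, zero_smul]
      calc -(w + x + x) = x - w - (3 : ZMod 3) • x := by module
        _ = x - w := by rw [e, sub_zero]
    · intro D _; simp
    · intro w _; simp
  have : (Finset.univ.filter fun D : Fin 6 → ZMod 3 => D ≠ 0 ∧ D + x ∈ T ∧ D - x ∈ T)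
      = (Finset.univ.filter fun D : Fin 6 → ZMod 3 => D + x ∈ T ∧ D - x ∈ T).erase 0 := by
    ext D; simp
  rw [this, Finset.card_erase_of_mem h0, h13]

theorem card_dualSet_perp (hT : IsPartialDiffSet T) (hx : x ∈ T) :
    ((dualSet T).filter fun h => x ⬝ᵥ h = 0).card = 32 := by
  have := charSum_eq_card (dualSet T) x
  rw [hT.charSum_dualSet, if_pos hx, if_neg (hT.ne_zero hx), hT.card_dualSet] at this
  push_cast at this
  omega

end IsPartialDiffSet

/-! ### Frames: the six three-point lines through x -/

/-- Representatives `D 0, …, D 5` of the six lines through `x` that carry three points of `T`. -/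
structure IsFrame (T : Finset (Fin 6 → ZMod 3)) (x : Fin 6 → ZMod 3)
    (D : Fin 6 → Fin 6 → ZMod 3) : Prop where
  pds : IsPartialDiffSet T
  mem : x ∈ T
  hole : ∀ i, IsPartialDiffSet.IsHole T x (D i)
  ne : ∀ i j, i ≠ j → D i ≠ D j ∧ D i ≠ -D j

/-- The elements of the dual set orthogonal to `x`. -/
def dualPerp (T : Finset (Fin 6 → ZMod 3)) (x : Fin 6 → ZMod 3) : Finset (Fin 6 → ZMod 3) :=
  (dualSet T).filter fun h => x ⬝ᵥ h = 0

theorem IsPartialDiffSet.exists_isFrame {T : Finset (Fin 6 → ZMod 3)} (hT : IsPartialDiffSet T) :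
    ∃ x D, IsFrame T x D := by
  obtain ⟨x, hx⟩ : T.Nonempty := Finset.card_pos.mp (by rw [hT.card_eq]; norm_num)
  obtain ⟨D, hD, hne⟩ := exists_neg_representatives 6
    (Finset.univ.filter fun D : Fin 6 → ZMod 3 => D ≠ 0 ∧ D + x ∈ T ∧ D - x ∈ T)
    (by
      intro v hv
      simp only [Finset.mem_filter, Finset.mem_univ, true_and] at hv ⊢
      exact IsPartialDiffSet.IsHole.neg hT hv)
    (by simp) (by rw [hT.card_holes hx])
  refine ⟨x, D, hT, hx, fun i => ?_, hne⟩
  exact (Finset.mem_filter.mp (hD i)).2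

namespace IsFrame

variable {T : Finset (Fin 6 → ZMod 3)} {x : Fin 6 → ZMod 3} {D : Fin 6 → Fin 6 → ZMod 3}

theorem card_dualPerp (hF : IsFrame T x D) : (dualPerp T x).card = 32 :=
  hF.pds.card_dualSet_perp hF.mem

theorem card_zero (hF : IsFrame T x D) (i : Fin 6) :
    ((dualPerp T x).filter fun h => D i ⬝ᵥ h = 0).card = 2 := by
  rw [dualPerp, Finset.filter_filter]
  exact ((hF.hole i).notMem_and_card hF.pds hF.mem).2

theorem zero_unique (hF : IsFrame T x D) {h : Fin 6 → ZMod 3} (hh : h ∈ dualPerp T x)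
    {i j : Fin 6} (hi : D i ⬝ᵥ h = 0) (hj : D j ⬝ᵥ h = 0) : i = j := by
  by_contra hij
  rw [dualPerp, Finset.mem_filter] at hh
  exact ((hF.hole i).pair hF.pds hF.mem (hF.hole j) (hF.ne i j hij).1 (hF.ne i j hij).2).2
    h hh.1 hh.2 hi hj

/-- By `IsHole.pair` the line through `x` and `a • D i - b • D j` has no further point of `T`, so
the dual count takes its maximal value 14. -/
theorem card_pair (hF : IsFrame T x D) {i j : Fin 6} (hij : i ≠ j) {a b : ZMod 3}
    (ha : a ≠ 0) (hb : b ≠ 0) :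
    ((dualPerp T x).filter fun h => a * (D i ⬝ᵥ h) = b * (D j ⬝ᵥ h)).card = 14 := by
  have hp := ((hF.hole i).pair hF.pds hF.mem (hF.hole j) (hF.ne i j hij).1 (hF.ne i j hij).2).1
  have key := hF.pds.card_dualSet_filter_add hF.mem (v := a • D i + (-b) • D j) fun t h => by
    exact hp t a (-b) ha (neg_ne_zero.mpr hb) (by rw [h]; simp)
  have h0 : (Finset.univ.filter fun t : ZMod 3 => a • D i + (-b) • D j + t • x ∈ T) = ∅ := by
    rw [Finset.filter_eq_empty_iff]
    exact fun t _ h => hp t a (-b) ha (neg_ne_zero.mpr hb) (Finset.mem_insert_of_mem h)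
  rw [h0, Finset.card_empty, mul_zero, add_zero] at key
  rw [← key, dualPerp, Finset.filter_filter]
  congr 1
  ext h
  simp only [Finset.mem_filter, add_dotProduct, smul_dotProduct, smul_eq_mul, neg_mul,
    ← sub_eq_add_neg, sub_eq_zero]

/-- A linear relation between the `D i` modulo `x` involves all of them. -/
theorem relation_ne_zero (hF : IsFrame T x D) {a : Fin 6 → ZMod 3} {b : ZMod 3} (ha : a ≠ 0)
    (hab : ∑ i, a i • D i = b • x) (i : Fin 6) : a i ≠ 0 := by
  intro hi0
  set S := Finset.univ.filter fun i => a i ≠ 0 with hS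
  set k := S.card with hk
  have hmemS : ∀ {i}, i ∈ S ↔ a i ≠ 0 := by simp [hS]
  have hk1 : 1 ≤ k := by
    obtain ⟨j, hj⟩ := Function.ne_iff.mp ha
    exact Finset.card_pos.mpr ⟨j, hmemS.mpr hj⟩
  have hk5 : k ≤ 5 := by
    have : S ⊂ Finset.univ := Finset.ssubset_univ_iff.mpr fun h => by
      have := Finset.mem_univ i
      rw [← h] at this
      exact hmemS.mp this hi0
    have := Finset.card_lt_card this
    simp at this
    omega
  let y : (Fin 6 → ZMod 3) → Fin 6 → ZMod 3 := fun h i => a i * (D i ⬝ᵥ h)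
  -- Two distinct coordinates in `S` agree in 14 words, a coordinate with itself in all 32: 14k(k -
  -- 1) + 32k.
  have total : ∑ h ∈ dualPerp T x, ∑ i ∈ S, ∑ j ∈ S, (if y h i = y h j then 1 else 0)
      = 14 * (k * k) + 18 * k := by
    rw [Finset.sum_comm]
    have inner : ∀ i ∈ S, ∑ h ∈ dualPerp T x, ∑ j ∈ S, (if y h i = y h j then 1 else 0)
        = 14 * k + 18 := by
      intro i hi
      rw [Finset.sum_comm]
      have : ∀ j ∈ S, ∑ h ∈ dualPerp T x, (if y h i = y h j then 1 else 0)
          = 14 + (if i = j then 18 else 0) := by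
        intro j hj
        rw [← Finset.card_filter]
        split_ifs with hij
        · subst hij; simp [hF.card_dualPerp]
        · exact hF.card_pair hij (hmemS.mp hi) (hmemS.mp hj)
      rw [Finset.sum_congr rfl this, Finset.sum_add_distrib, Finset.sum_ite_eq, if_pos hi]
      simp [hk, mul_comm]
    rw [Finset.sum_congr rfl inner]
    simp only [Finset.sum_const, smul_eq_mul, ← hk]
    ring
  have zeros : ∑ h ∈ dualPerp T x, (S.filter (y h · = 0)).card = 2 * k := by
    simp only [Finset.card_filter]
    rw [Finset.sum_comm]
    have : ∀ i ∈ S, ∑ h ∈ dualPerp T x, (if y h i = 0 then 1 else 0) = 2 := by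
      intro i hi
      rw [← Finset.card_filter, ← hF.card_zero i]
      congr 1
      ext h
      simp [y, hmemS.mp hi]
    rw [Finset.sum_congr rfl this]
    simp [hk, mul_comm]
  have point : ∀ h ∈ dualPerp T x, (S.filter (y h · = 0)).card ≤ 1 ∧
      k = (S.filter (y h · = 0)).card + (S.filter (y h · = 1)).card
        + (S.filter (y h · = 2)).card ∧
      ((S.filter (y h · = 1)).card + 2 * (S.filter (y h · = 2)).card) % 3 = 0 ∧
      ∑ i ∈ S, ∑ j ∈ S, (if y h i = y h j then 1 else 0)
        = (S.filter (y h · = 0)).card ^ 2 + (S.filter (y h · = 1)).card ^ 2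
        + (S.filter (y h · = 2)).card ^ 2 := by
    intro h hh
    refine ⟨?_, card_eq_add_fiber S (y h), ?_, sum_sum_ite_eq_fiber S (y h)⟩
    · refine Finset.card_le_one.mpr fun i hi j hj => ?_
      rw [Finset.mem_filter, hmemS] at hi hj
      exact hF.zero_unique hh ((mul_eq_zero.mp hi.2).resolve_left hi.1)
        ((mul_eq_zero.mp hj.2).resolve_left hj.1)
    · have e1 : ∑ i ∈ S, y h i = 0 := by
        have : ∑ i ∈ S, y h i = ∑ i, y h i := by
          refine Finset.sum_subset (Finset.subset_univ _) fun i _ hi => ?_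
          rw [hmemS, not_not] at hi
          simp [y, hi]
        rw [this]
        have e2 := congrArg (· ⬝ᵥ h) hab
        simp only [sum_dotProduct, smul_dotProduct, smul_eq_mul] at e2
        rw [dualPerp, Finset.mem_filter] at hh
        rw [hh.2, mul_zero] at e2
        exact e2
      rw [sum_eq_fiber, ZMod.natCast_eq_zero_iff] at e1
      omega
  -- For k ≤ 5, the conditions n₀ ≤ 1 and n₁ ≡ n₂ mod 3 make the number of agreeing pairs in a word
  -- depend on n₀ only: it is `α` for n₀ = 0 and `α + β` for n₀ = 1, with a free choice where that
  -- n₀ cannot occur. Summed over the 32 words, with 2k zeros in all, this never matches the total.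
  -- For k = 6 the fibres 6 + 0 and 3 + 3 both occur, so full relations escape.
  obtain ⟨α, β, hαβ, hne⟩ : ∃ α β : ℤ, (∀ n0 n1 n2 : ℕ, n0 ≤ 1 → k = n0 + n1 + n2 →
      (n1 + 2 * n2) % 3 = 0 → ((n0 ^ 2 + n1 ^ 2 + n2 ^ 2 : ℕ) : ℤ) = α + β * n0) ∧
      32 * α + β * (2 * k) ≠ 14 * (k * k) + 18 * k := by
    have aux : ∀ α β : ℤ, (∀ n0 < 2, ∀ n1 < 6, ∀ n2 < 6, k = n0 + n1 + n2 →
        (n1 + 2 * n2) % 3 = 0 → ((n0 ^ 2 + n1 ^ 2 + n2 ^ 2 : ℕ) : ℤ) = α + β * n0) →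
        ∀ n0 n1 n2 : ℕ, n0 ≤ 1 → k = n0 + n1 + n2 →
        (n1 + 2 * n2) % 3 = 0 → ((n0 ^ 2 + n1 ^ 2 + n2 ^ 2 : ℕ) : ℤ) = α + β * n0 :=
      fun α β H n0 n1 n2 h0 h1 h2 => H n0 (by omega) n1 (by omega) n2 (by omega) h1 h2
    clear_value k
    interval_cases k
    · exact ⟨0, 1, aux _ _ (by decide), by norm_num⟩
    · exact ⟨2, 0, aux _ _ (by decide), by norm_num⟩
    · exact ⟨9, -6, aux _ _ (by decide), by norm_num⟩
    · exact ⟨8, 2, aux _ _ (by decide), by norm_num⟩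
    · exact ⟨17, -8, aux _ _ (by decide), by norm_num⟩
  apply hne
  have e : ((∑ h ∈ dualPerp T x, ∑ i ∈ S, ∑ j ∈ S, (if y h i = y h j then 1 else 0) : ℕ) : ℤ)
      = ∑ h ∈ dualPerp T x, (α + β * ((S.filter (y h · = 0)).card : ℤ)) := by
    rw [Nat.cast_sum]
    refine Finset.sum_congr rfl fun h hh => ?_
    obtain ⟨p1, p2, p3, p4⟩ := point h hh
    rw [p4]
    exact hαβ _ _ _ p1 p2 p3
  rw [total, Finset.sum_add_distrib, ← Finset.mul_sum, ← Nat.cast_sum, zeros] at e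
  simp only [Finset.sum_const, hF.card_dualPerp, nsmul_eq_mul] at e
  push_cast at e
  linarith

theorem smul (hF : IsFrame T x D) {a : Fin 6 → ZMod 3} (ha : ∀ i, a i ≠ 0) :
    IsFrame T x fun i => a i • D i := by
  have sgn : ∀ i, a i = 1 ∨ a i = -1 := fun i =>
    (ZMod.three_cases (a i)).resolve_left (ha i)
  refine ⟨hF.pds, hF.mem, fun i => ?_, fun i j hij => ?_⟩
  · rcases sgn i with h | h
    · simpa [h] using hF.hole i
    · simpa [h] using (hF.hole i).neg hF.pds
  · have := hF.ne i j hij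
    rcases sgn i with h | h <;> rcases sgn j with h' | h' <;>
      simp only [h, h', one_smul, neg_smul, neg_neg, ne_eq, neg_inj]
    · exact this
    · exact this.symm
    · exact ⟨fun e => this.2 (by rw [← e, neg_neg]), fun e => this.1 e⟩
    · exact ⟨this.1, fun e => this.2 (by rw [← e, neg_neg])⟩

/-- The six `D i` and `x` are seven vectors in dimension six, hence dependent. In the relation no
coefficient of a `D i` vanishes, and nonzero elements of 𝔽₃ are signs, which the `D i` absorb. -/
theorem exists_sum_eq (hF : IsFrame T x D) :
    ∃ D', IsFrame T x D' ∧ ∃ b : ZMod 3, ∑ i, D' i = b • x := by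
  let L : ((Fin 6 → ZMod 3) × ZMod 3) →ₗ[ZMod 3] (Fin 6 → ZMod 3) :=
    (Fintype.linearCombination (ZMod 3) D).coprod ((LinearMap.id).smulRight (-x))
  have hker : LinearMap.ker L ≠ ⊥ := by
    apply LinearMap.ker_ne_bot_of_finrank_lt
    simp
  obtain ⟨⟨a, b⟩, hab, hne⟩ := (Submodule.ne_bot_iff _).mp hker
  have hrel : ∑ i, a i • D i = b • x := by
    have : L (a, b) = 0 := hab
    simp only [L, LinearMap.coprod_apply, Fintype.linearCombination_apply, LinearMap.smulRight_apply,
      LinearMap.id_apply, smul_neg, ← sub_eq_add_neg, sub_eq_zero] at this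
    exact this
  have ha : a ≠ 0 := by
    rintro rfl
    apply hne
    have hb : b = 0 := by
      by_contra hb
      have : b • x = 0 := by rw [← hrel]; simp
      exact (smul_ne_zero hb (hF.pds.ne_zero hF.mem)) this
    rw [hb]; rfl
  exact ⟨_, hF.smul (hF.relation_ne_zero ha hrel), b, hrel⟩

theorem comp (hF : IsFrame T x D) (σ : Equiv.Perm (Fin 6)) : IsFrame T x (D ∘ σ) :=
  ⟨hF.pds, hF.mem, fun i => hF.hole (σ i), fun _ _ hij => hF.ne _ _ (σ.injective.ne hij)⟩

/-- A relation that omits `D 5` is trivial by `relation_ne_zero`, so `D 0, …, D 4, x` is a basis. -/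
theorem isUnit_update (hF : IsFrame T x D) :
    IsUnit (Matrix.of (Function.update D 5 x)) := by
  rw [← Matrix.vecMul_injective_iff_isUnit]
  refine (injective_iff_map_eq_zero
    (Matrix.vecMulLinear (Matrix.of (Function.update D 5 x)))).mpr fun a ha => ?_
  have h1 : ∑ i, Function.update a 5 0 i • D i = (-a 5) • x := by
    have : Matrix.vecMul a (Matrix.of (Function.update D 5 x)) = 0 := ha
    rw [Matrix.vecMul_eq_sum] at this
    rw [Fin.sum_univ_castSucc] at this ⊢
    simp only [neg_smul]
    rw [eq_neg_iff_add_eq_zero, ← this]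
    have e5 : Fin.last 5 = (5 : Fin 6) := rfl
    rw [e5]
    simp only [Function.update_self, zero_smul, add_zero]
    congr 1
  have h2 : Function.update a 5 0 = 0 := by
    by_contra hne
    exact hF.relation_ne_zero hne h1 5 (by simp)
  have h3 : a 5 = 0 := by
    by_contra h5
    rw [h2] at h1
    simp only [Pi.zero_apply, zero_smul, Finset.sum_const_zero] at h1
    exact smul_ne_zero (neg_ne_zero.mpr h5) (hF.pds.ne_zero hF.mem) h1.symm
  rw [← Function.update_eq_self 5 a, h3]
  exact h2

theorem exists_functional (hF : IsFrame T x D) (g : Fin 5 → ZMod 3) :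
    ∃ G : Fin 6 → ZMod 3, x ⬝ᵥ G = 1 ∧ ∀ i : Fin 5, D i.castSucc ⬝ᵥ G = g i := by
  obtain ⟨G, hG⟩ := (Matrix.mulVec_surjective_iff_isUnit.mpr hF.isUnit_update)
    (Fin.snoc g (1 : ZMod 3) : Fin 6 → ZMod 3)
  refine ⟨G, ?_, fun i => ?_⟩
  · have := congrFun hG 5
    simp only [Matrix.mulVec, Matrix.of_apply, Function.update_self] at this
    rw [this]; exact Fin.snoc_last (α := fun _ => ZMod 3) _ _
  · have := congrFun hG i.castSucc
    have hi : i.castSucc ≠ (5 : Fin 6) := (Fin.castSucc_lt_last i).ne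
    simp only [Matrix.mulVec, Matrix.of_apply, Function.update_of_ne hi] at this
    rw [this]; exact Fin.snoc_castSucc (α := fun _ => ZMod 3) _ _ _

theorem word_injOn (hF : IsFrame T x D) :
    Set.InjOn (fun h i => D i ⬝ᵥ h) (dualPerp T x : Set (Fin 6 → ZMod 3)) := by
  intro h hh h' hh' e
  apply Matrix.mulVec_injective_iff_isUnit.mpr hF.isUnit_update
  funext i
  simp only [Finset.mem_coe, dualPerp, Finset.mem_filter] at hh hh'
  by_cases hi : i = 5
  · subst hi; simp [Matrix.mulVec, hh.2, hh'.2]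
  · simpa [Matrix.mulVec, Function.update_of_ne hi] using congrFun e i

end IsFrame

/-! ### Classification of the word sets -/

/-- The combinatorial properties of the set of words `(h · D i)ᵢ`, `h` in the dual set. -/
structure IsWordSet (Ω : Finset (Fin 6 → ZMod 3)) : Prop where
  neg_mem : ∀ c ∈ Ω, -c ∈ Ω
  sum_eq : ∀ c ∈ Ω, ∑ i, c i = 0
  zero_unique : ∀ c ∈ Ω, ∀ i j, c i = 0 → c j = 0 → i = j
  card_eq : Ω.card = 32
  card_zero : ∀ i, (Ω.filter fun c => c i = 0).card = 2
  card_pair : ∀ i j, i ≠ j → (Ω.filter fun c => c i = c j).card = 14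

/-- The word `1 1 1 2 2 2`. -/
def halfWord : Fin 6 → ZMod 3 := ![1, 1, 1, 2, 2, 2]

/-- The word with entry `0` at `i`, `2` at `j` and `1` elsewhere. -/
def unitWord (i j : Fin 6) : Fin 6 → ZMod 3 := fun k => if k = i then 0 else if k = j then 2 else 1

/-- The nonvanishing words with sum `0`. -/
def fullWords : Finset (Fin 6 → ZMod 3) :=
  Finset.univ.filter fun c => (∀ i, c i ≠ 0) ∧ ∑ i, c i = 0

theorem card_fullWords : fullWords.card = 22 := by decide +kernel

/-- Up to sign, the entries 1 and 2 have multiplicities (6, 0) or (3, 3), or (4, 1) beside one zero;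
the sums of squares are 36, 18 and 1 + 16 + 1 = 18. -/
theorem sum_sum_ite_word : ∀ c : Fin 6 → ZMod 3, ∑ i, c i = 0 →
    (∀ i j, c i = 0 → c j = 0 → i = j) →
    (∑ i, ∑ j, if c i = c j then 1 else 0) = 18 + if c = 1 ∨ c = -1 then 18 else 0 := by
  decide +kernel

theorem eq_unitWord : ∀ i, ∀ c : Fin 6 → ZMod 3, ∑ i, c i = 0 →
    (∀ i j, c i = 0 → c j = 0 → i = j) → c i = 0 →
    ∃ j, j ≠ i ∧ (c = unitWord i j ∨ c = -unitWord i j) := by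
  decide +kernel

theorem eq_halfWord_of_monotone : ∀ c : Fin 6 → ZMod 3, ∑ i, c i = 0 → (∀ i, c i ≠ 0) → c ≠ 1 →
    c ≠ -1 → (∀ i j, i ≤ j → (c i).val ≤ (c j).val) → c = halfWord := by
  decide +kernel

theorem unitWord_apply_eq_iff : ∀ i j a b : Fin 6, j ≠ i → a ≠ b →
    (if unitWord i j a = unitWord i j b then 1 else 0 : ℤ)
      = if i = a ∨ i = b then 0 else
        1 - (if j = a then 1 else 0) - (if j = b then 1 else 0) := by
  decide +kernel

/-- Any two positions agree in 10 of the 22 full words; `±halfWord` are among these exactly if the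
positions lie in the same half. -/
theorem card_fullWords_pair : ∀ a b : Fin 6, a ≠ b →
    ((fullWords.filter fun c => c ≠ halfWord ∧ c ≠ -halfWord).filter fun c => c a = c b).card
      = if halfWord a = halfWord b then 8 else 10 := by
  decide +kernel

theorem ne_neg_of_apply_ne_zero {n : ℕ} {c : Fin n → ZMod 3} {k : Fin n} (hk : c k ≠ 0) :
    c ≠ -c := by
  intro h
  have h1 := congrFun h k
  have key : ∀ a : ZMod 3, a = -a → a = 0 := by decide
  exact hk (key _ h1)

theorem unitWord_ne_neg (i j : Fin 6) : unitWord i j ≠ -unitWord i j := by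
  revert i j; decide +kernel

/-- For `E i k` the indicator of `j i = k`: the equations force the map `j` to preserve the halves
{0, 1, 2} and {3, 4, 5}, with row and column sums 1 in both blocks. -/
theorem cyclic_column_sums {E : Fin 6 → Fin 6 → ℤ} (hE0 : ∀ i k, 0 ≤ E i k)
    (hEi : ∀ i, E i i = 0) (hE1 : ∀ i, E i 0 + E i 1 + E i 2 + E i 3 + E i 4 + E i 5 = 1)
    (hE : ∀ a b, a ≠ b → ∑ i, (if i = a ∨ i = b then 0 else 1 - E i a - E i b)
      = if halfWord a = halfWord b then 3 else 2) :
    (E 0 1 + E 0 2 = 1 ∧ E 1 0 + E 1 2 = 1 ∧ E 2 0 + E 2 1 = 1 ∧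
      E 1 0 + E 2 0 = 1 ∧ E 0 1 + E 2 1 = 1) ∧
    (E 3 4 + E 3 5 = 1 ∧ E 4 3 + E 4 5 = 1 ∧ E 5 3 + E 5 4 = 1 ∧
      E 4 3 + E 5 3 = 1 ∧ E 3 4 + E 5 4 = 1) := by
  have t1 : ∀ a b : Fin 6, (halfWord a = halfWord b) = ((a : ℕ) / 3 = (b : ℕ) / 3) := by
    intro a b; exact propext (by revert a b; decide)
  simp only [t1, Fin.sum_univ_six] at hE
  have q01 := hE 0 1 (by decide)
  have q02 := hE 0 2 (by decide)
  have q03 := hE 0 3 (by decide)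
  have q04 := hE 0 4 (by decide)
  have q05 := hE 0 5 (by decide)
  have q12 := hE 1 2 (by decide)
  have q13 := hE 1 3 (by decide)
  have q14 := hE 1 4 (by decide)
  have q15 := hE 1 5 (by decide)
  have q23 := hE 2 3 (by decide)
  have q24 := hE 2 4 (by decide)
  have q25 := hE 2 5 (by decide)
  have q34 := hE 3 4 (by decide)
  have q35 := hE 3 5 (by decide)
  have q45 := hE 4 5 (by decide)
  simp at q01 q02 q03 q04 q05 q12 q13 q14 q15 q23 q24 q25 q34 q35 q45
  clear hE t1
  have e0 := hEi 0
  have e1 := hEi 1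
  have e2 := hEi 2
  have e3 := hEi 3
  have e4 := hEi 4
  have e5 := hEi 5
  have s0 := hE1 0
  have s1 := hE1 1
  have s2 := hE1 2
  have s3 := hE1 3
  have s4 := hE1 4
  have s5 := hE1 5
  -- Adding the equations for the three pairs inside the first half gives cXY = 2 · cYX for the sums
  -- over the two off-diagonal blocks; the second half gives cYX = 2 · cXY. So both sums vanish.
  have cXY : E 0 3 + E 0 4 + E 0 5 + E 1 3 + E 1 4 + E 1 5 + E 2 3 + E 2 4 + E 2 5 = 0 := by
    linarith only [e0, e1, e2, e3, e4, e5, s0, s1, s2, s3, s4, s5, q01, q02, q12, q34, q35, q45]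
  have cYX : E 3 0 + E 4 0 + E 5 0 + E 3 1 + E 4 1 + E 5 1 + E 3 2 + E 4 2 + E 5 2 = 0 := by
    linarith only [e0, e1, e2, e3, e4, e5, s0, s1, s2, s3, s4, s5, q01, q02, q12, q34, q35, q45]
  clear q01 q02 q12 q34 q35 q45
  have zXY : E 0 3 = 0 ∧ E 0 4 = 0 ∧ E 0 5 = 0 ∧ E 1 3 = 0 ∧ E 1 4 = 0 ∧ E 1 5 = 0 ∧ E 2 3 = 0 ∧ E 2 4 = 0 ∧ E 2 5 = 0 := by
    refine ⟨?_, ?_, ?_, ?_, ?_, ?_, ?_, ?_, ?_⟩ <;>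
      linarith only [cXY, hE0 0 3, hE0 0 4, hE0 0 5, hE0 1 3, hE0 1 4, hE0 1 5, hE0 2 3, hE0 2 4, hE0 2 5]
  have zYX : E 3 0 = 0 ∧ E 4 0 = 0 ∧ E 5 0 = 0 ∧ E 3 1 = 0 ∧ E 4 1 = 0 ∧ E 5 1 = 0 ∧ E 3 2 = 0 ∧ E 4 2 = 0 ∧ E 5 2 = 0 := by
    refine ⟨?_, ?_, ?_, ?_, ?_, ?_, ?_, ?_, ?_⟩ <;>
      linarith only [cYX, hE0 3 0, hE0 4 0, hE0 5 0, hE0 3 1, hE0 4 1, hE0 5 1, hE0 3 2, hE0 4 2, hE0 5 2]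
  obtain ⟨z03, z04, z05, z13, z14, z15, z23, z24, z25⟩ := zXY
  obtain ⟨z30, z40, z50, z31, z41, z51, z32, z42, z52⟩ := zYX
  simp only [e0, e1, e2, e3, e4, e5, z03, z04, z05, z13, z14, z15, z23, z24, z25, z30, z40, z50, z31, z41, z51, z32, z42, z52, add_zero, zero_add,
    sub_zero] at s0 s1 s2 s3 s4 s5 q03 q04 q05 q13 q14 q15 q23 q24 q25
  refine ⟨⟨s0, s1, s2, ?_, ?_⟩, s3, s4, s5, ?_, ?_⟩ <;>
    linarith only [s0, s1, s2, s3, s4, s5, q03, q04, q05, q13, q14, q15, q23, q24, q25]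

namespace IsWordSet

variable {Ω : Finset (Fin 6 → ZMod 3)}

theorem neg_mem_iff (hΩ : IsWordSet Ω) {c : Fin 6 → ZMod 3} : -c ∈ Ω ↔ c ∈ Ω :=
  ⟨fun h => by simpa using hΩ.neg_mem _ h, hΩ.neg_mem c⟩

/-- Counting agreements in all words gives 6 · (6 · 14 + 18) = 612 = 32 · 18 + 2 · 18, so exactly
two words are constant. -/
theorem one_mem (hΩ : IsWordSet Ω) : 1 ∈ Ω := by
  have total : ∑ c ∈ Ω, ∑ i, ∑ j, (if c i = c j then 1 else 0) = 612 := by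
    rw [Finset.sum_comm]
    have inner : ∀ i, ∑ c ∈ Ω, ∑ j, (if c i = c j then 1 else 0) = 102 := by
      intro i
      rw [Finset.sum_comm]
      have : ∀ j, ∑ c ∈ Ω, (if c i = c j then 1 else 0) = 14 + (if i = j then 18 else 0) := by
        intro j
        rw [← Finset.card_filter]
        split_ifs with hij
        · subst hij; simp [hΩ.card_eq]
        · exact hΩ.card_pair i j hij
      rw [Finset.sum_congr rfl fun j _ => this j, Finset.sum_add_distrib, Finset.sum_ite_eq]
      simp
    rw [Finset.sum_congr rfl fun i _ => inner i]
    simp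
  rw [Finset.sum_congr rfl fun c hc => sum_sum_ite_word c (hΩ.sum_eq c hc) (hΩ.zero_unique c hc),
    Finset.sum_add_distrib, ← Finset.sum_filter] at total
  simp only [Finset.sum_const, hΩ.card_eq, smul_eq_mul] at total
  have : (Ω.filter fun c => c = 1 ∨ c = -1).card = 2 := by omega
  obtain ⟨c, hc⟩ : (Ω.filter fun c => c = 1 ∨ c = -1).Nonempty := Finset.card_pos.mp (by omega)
  rw [Finset.mem_filter] at hc
  rcases hc with ⟨hc, rfl | rfl⟩
  · exact hc
  · simpa using hΩ.neg_mem _ hc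

theorem card_full (hΩ : IsWordSet Ω) : (Ω.filter fun c => ∀ i, c i ≠ 0).card = 20 := by
  have h1 : (Ω.filter fun c => ¬ ∀ i, c i ≠ 0).card = 12 := by
    have : (Ω.filter fun c => ¬ ∀ i, c i ≠ 0)
        = Finset.univ.biUnion fun i => Ω.filter fun c => c i = 0 := by
      ext c; simp
    rw [this, Finset.card_biUnion, Finset.sum_congr rfl fun i _ => hΩ.card_zero i]
    · simp
    · intro i _ j _ hij
      rw [Function.onFun, Finset.disjoint_left]
      intro c hc hc'
      rw [Finset.mem_filter] at hc hc'
      exact hij (hΩ.zero_unique c hc.1 i j hc.2 hc'.2)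
  have := Finset.card_filter_add_card_filter_not (s := Ω) (fun c => ∀ i, c i ≠ 0)
  rw [hΩ.card_eq] at this
  omega

/-- Exactly one pair `±e` of full words is missing. -/
theorem exists_missing (hΩ : IsWordSet Ω) :
    ∃ e ∈ fullWords, e ∉ Ω ∧ ∀ c ∈ fullWords, c ≠ e → c ≠ -e → c ∈ Ω := by
  have hsub : (Ω.filter fun c => ∀ i, c i ≠ 0) ⊆ fullWords := by
    intro c hc
    rw [Finset.mem_filter] at hc
    simp [fullWords, hc.2, hΩ.sum_eq c hc.1]
  have hc2 : (fullWords \ (Ω.filter fun c => ∀ i, c i ≠ 0)).card = 2 := by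
    rw [Finset.card_sdiff_of_subset hsub, card_fullWords, hΩ.card_full]
  obtain ⟨e, he⟩ : (fullWords \ (Ω.filter fun c => ∀ i, c i ≠ 0)).Nonempty :=
    Finset.card_pos.mp (by omega)
  have hmem : ∀ c, c ∈ fullWords \ (Ω.filter fun c => ∀ i, c i ≠ 0) ↔ c ∈ fullWords ∧ c ∉ Ω := by
    intro c
    simp only [Finset.mem_sdiff, Finset.mem_filter, not_and, fullWords, Finset.mem_univ, true_and]
    exact ⟨fun h => ⟨h.1, fun h' => h.2 h' h.1.1⟩, fun h => ⟨h.1, fun h' => absurd h' h.2⟩⟩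
  have he' := (hmem e).mp he
  have hne : -e ∈ fullWords \ (Ω.filter fun c => ∀ i, c i ≠ 0) := by
    rw [hmem, hΩ.neg_mem_iff]
    refine ⟨?_, he'.2⟩
    have := he'.1
    simp only [fullWords, Finset.mem_filter, Finset.mem_univ, true_and] at this ⊢
    simpa using this
  have hee : e ≠ -e := by
    have := he'.1
    simp only [fullWords, Finset.mem_filter, Finset.mem_univ, true_and] at this
    exact ne_neg_of_apply_ne_zero (this.1 0)
  have hpair : {e, -e} = fullWords \ (Ω.filter fun c => ∀ i, c i ≠ 0) := by
    apply Finset.eq_of_subset_of_card_le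
    · intro c hc
      rcases Finset.mem_insert.mp hc with rfl | hc
      · exact he
      · rw [Finset.mem_singleton.mp hc]; exact hne
    · rw [hc2, Finset.card_pair hee]
  refine ⟨e, he'.1, he'.2, fun c hc h1 h2 => ?_⟩
  by_contra hcΩ
  have : c ∈ fullWords \ (Ω.filter fun c => ∀ i, c i ≠ 0) := (hmem c).mpr ⟨hc, hcΩ⟩
  rw [← hpair] at this
  simp [h1, h2] at this

/-- The missing full word is not `±1`, so it has three entries 1 and three entries 2; sorting them
yields `halfWord`. -/
theorem exists_perm_halfWord (hΩ : IsWordSet Ω) :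
    ∃ σ : Equiv.Perm (Fin 6), ∀ c ∈ Ω, c ∘ σ ≠ halfWord := by
  obtain ⟨e, he, heΩ, -⟩ := hΩ.exists_missing
  simp only [fullWords, Finset.mem_filter, Finset.mem_univ, true_and] at he
  set σ := Tuple.sort fun i => (e i).val
  have hσ : e ∘ σ = halfWord := by
    apply eq_halfWord_of_monotone
    · rw [← he.2]; exact Equiv.sum_comp σ e
    · exact fun i => he.1 _
    · intro h
      apply heΩ
      have : e = 1 := by
        funext i; simpa using congrFun h (σ.symm i)
      rw [this]; exact hΩ.one_mem
    · intro h
      apply heΩ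
      have : e = -1 := by
        funext i; simpa using congrFun h (σ.symm i)
      rw [this]; exact hΩ.neg_mem _ hΩ.one_mem
    · exact fun i j hij => Tuple.monotone_sort (fun i => (e i).val) hij
  refine ⟨σ, fun c hc h => heΩ ?_⟩
  have : c = e := by
    rw [← hσ] at h
    exact σ.surjective.injective_comp_right h
  exact this ▸ hc

theorem exists_unitWord (hΩ : IsWordSet Ω) (i : Fin 6) :
    ∃ j, j ≠ i ∧ (Ω.filter fun c => c i = 0) = {unitWord i j, -unitWord i j} := by
  obtain ⟨c, hc⟩ : (Ω.filter fun c => c i = 0).Nonempty :=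
    Finset.card_pos.mp (by rw [hΩ.card_zero]; norm_num)
  rw [Finset.mem_filter] at hc
  obtain ⟨j, hj, h⟩ := eq_unitWord i c (hΩ.sum_eq c hc.1) (hΩ.zero_unique c hc.1) hc.2
  have hw : unitWord i j ∈ Ω := by
    rcases h with rfl | rfl
    · exact hc.1
    · simpa using hΩ.neg_mem _ hc.1
  have h0 : unitWord i j i = 0 := by simp [unitWord]
  refine ⟨j, hj, (Finset.eq_of_subset_of_card_le ?_ ?_).symm⟩
  · intro c hc
    rw [Finset.mem_filter]
    rcases Finset.mem_insert.mp hc with rfl | hc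
    · exact ⟨hw, h0⟩
    · rw [Finset.mem_singleton.mp hc]
      exact ⟨hΩ.neg_mem _ hw, by simp [h0]⟩
  · rw [hΩ.card_zero, Finset.card_pair (unitWord_ne_neg i j)]

theorem mem_iff_of_halfWord (hΩ : IsWordSet Ω) (hh : halfWord ∉ Ω) {c : Fin 6 → ZMod 3}
    (hc : ∀ i, c i ≠ 0) :
    c ∈ Ω ↔ c ∈ fullWords.filter fun c => c ≠ halfWord ∧ c ≠ -halfWord := by
  obtain ⟨e, he, heΩ, hall⟩ := hΩ.exists_missing
  have hhe : halfWord = e ∨ halfWord = -e := by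
    by_contra hcon
    rw [not_or] at hcon
    exact hh (hall _ (by decide +kernel) hcon.1 hcon.2)
  rw [Finset.mem_filter]
  constructor
  · intro h
    refine ⟨by simp [fullWords, hc, hΩ.sum_eq c h], fun h' => hh (h' ▸ h), fun h' => hh ?_⟩
    have := hΩ.neg_mem c h
    rwa [h', neg_neg] at this
  · rintro ⟨h1, h2, h3⟩
    rcases hhe with h | h
    · exact hall c h1 (h ▸ h2) (h ▸ h3)
    · exact hall c h1 (fun h' => h3 (by rw [h, neg_neg, h'])) (fun h' => h2 (by rw [h, h']))

/-- The equations satisfied by the positions of the entries `2` in the words with a zero. -/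
theorem sum_unitWord (hΩ : IsWordSet Ω) (hh : halfWord ∉ Ω) {j : Fin 6 → Fin 6}
    (hj : ∀ i, (Ω.filter fun c => c i = 0) = {unitWord i (j i), -unitWord i (j i)})
    {a b : Fin 6} (hab : a ≠ b) :
    ∑ i, (if unitWord i (j i) a = unitWord i (j i) b then 1 else 0 : ℤ)
      = if halfWord a = halfWord b then 3 else 2 := by
  -- Of the 14 words that agree in `a` and `b`, 8 or 10 are full; the remaining 6 or 4 come in pairs
  -- `±unitWord i (j i)`.
  have h1 : (((Ω.filter fun c => c a = c b).filter fun c => ∀ i, c i ≠ 0).card : ℤ)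
      = if halfWord a = halfWord b then 8 else 10 := by
    have : (Ω.filter fun c => c a = c b).filter (fun c => ∀ i, c i ≠ 0)
        = (fullWords.filter fun c => c ≠ halfWord ∧ c ≠ -halfWord).filter fun c => c a = c b := by
      ext c
      by_cases hc : ∀ i, c i ≠ 0
      · rw [Finset.mem_filter, Finset.mem_filter, hΩ.mem_iff_of_halfWord hh hc,
          Finset.mem_filter (p := fun c : Fin 6 → ZMod 3 => c a = c b)]
        exact ⟨fun h => h.1, fun h => ⟨h, hc⟩⟩
      · simp only [Finset.mem_filter, hc, and_false, fullWords, false_and]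
    rw [this, card_fullWords_pair a b hab]
    split_ifs <;> rfl
  have h2 : (((Ω.filter fun c => c a = c b).filter fun c => ¬ ∀ i, c i ≠ 0).card : ℤ)
      = ∑ i, 2 * (if unitWord i (j i) a = unitWord i (j i) b then 1 else 0 : ℤ) := by
    have : (Ω.filter fun c => c a = c b).filter (fun c => ¬ ∀ i, c i ≠ 0)
        = Finset.univ.biUnion fun i => (Ω.filter fun c => c i = 0).filter fun c => c a = c b := by
      ext c
      simp only [Finset.mem_filter, not_forall, not_not, Finset.mem_biUnion, Finset.mem_univ,
        true_and]
      exact ⟨fun ⟨⟨h, h'⟩, i, hi⟩ => ⟨i, ⟨h, hi⟩, h'⟩, fun ⟨i, ⟨h, hi⟩, h'⟩ => ⟨⟨h, h'⟩, i, hi⟩⟩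
    rw [this, Finset.card_biUnion]
    · push_cast
      refine Finset.sum_congr rfl fun i _ => ?_
      rw [hj i]
      split_ifs with h
      · rw [Finset.filter_true_of_mem, Finset.card_pair (unitWord_ne_neg i _)]; · rfl
        intro c hc
        rcases Finset.mem_insert.mp hc with rfl | hc
        · exact h
        · rw [Finset.mem_singleton.mp hc]; simp [h]
      · rw [Finset.filter_false_of_mem]; · simp
        intro c hc
        rcases Finset.mem_insert.mp hc with rfl | hc
        · exact h
        · rw [Finset.mem_singleton.mp hc]; simpa using h
    · intro i _ i' _ hii
      rw [Function.onFun, Finset.disjoint_left]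
      intro c hc hc'
      simp only [Finset.mem_filter] at hc hc'
      exact hii (hΩ.zero_unique c hc.1.1 i i' hc.1.2 hc'.1.2)
  have h3 := Finset.card_filter_add_card_filter_not (s := Ω.filter fun c => c a = c b)
    (fun c => ∀ i, c i ≠ 0)
  rw [hΩ.card_pair a b hab] at h3
  zify at h3
  rw [h1, h2, ← Finset.mul_sum] at h3
  split_ifs at h3 ⊢ <;> omega

/-- A 3 × 3 permutation matrix with zero diagonal is one of the two 3-cycles, and a single entry
decides which. -/
theorem cyclic (hΩ : IsWordSet Ω) (hh : halfWord ∉ Ω) {j : Fin 6 → Fin 6} (hne : ∀ i, j i ≠ i)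
    (hj : ∀ i, (Ω.filter fun c => c i = 0) = {unitWord i (j i), -unitWord i (j i)}) :
    (j 0 = 1 ∧ j 1 = 2 ∧ j 2 = 0 ∨ j 0 = 2 ∧ j 1 = 0 ∧ j 2 = 1) ∧
      (j 3 = 4 ∧ j 4 = 5 ∧ j 5 = 3 ∨ j 3 = 5 ∧ j 4 = 3 ∧ j 5 = 4) := by
  let E : Fin 6 → Fin 6 → ℤ := fun i k => if j i = k then 1 else 0
  have hE0 : ∀ i k, 0 ≤ E i k := fun i k => by simp only [E]; split_ifs <;> norm_num
  have hEi : ∀ i, E i i = 0 := fun i => by simp [E, hne i]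
  have hE1 : ∀ i, E i 0 + E i 1 + E i 2 + E i 3 + E i 4 + E i 5 = 1 := by
    intro i
    have : ∑ k, E i k = 1 := by simp [E]
    rwa [Fin.sum_univ_six] at this
  have hE : ∀ a b, a ≠ b → ∑ i, (if i = a ∨ i = b then 0 else 1 - E i a - E i b)
      = if halfWord a = halfWord b then 3 else 2 := by
    intro a b hab
    rw [← hΩ.sum_unitWord hh hj hab]
    exact Finset.sum_congr rfl fun i _ => (unitWord_apply_eq_iff i (j i) a b (hne i) hab).symm
  have hjE : ∀ i k, E i k ≠ 0 → j i = k := fun i k h => by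
    by_contra h'; exact h (by simp [E, h'])
  have pos : ∀ i k, E i k = 0 ∨ E i k = 1 := fun i k => by simp only [E]; split_ifs <;> simp
  obtain ⟨⟨x1, x2, x3, x4, x5⟩, y1, y2, y3, y4, y5⟩ := cyclic_column_sums hE0 hEi hE1 hE
  clear hE hE1 hEi
  clear_value E
  constructor
  · rcases pos 0 1 with h | h
    · right
      exact ⟨hjE 0 2 (by omega), hjE 1 0 (by omega), hjE 2 1 (by omega)⟩
    · left
      exact ⟨hjE 0 1 (by omega), hjE 1 2 (by omega), hjE 2 0 (by omega)⟩
  · rcases pos 3 4 with h | h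
    · right
      exact ⟨hjE 3 5 (by omega), hjE 4 3 (by omega), hjE 5 4 (by omega)⟩
    · left
      exact ⟨hjE 3 4 (by omega), hjE 4 5 (by omega), hjE 5 3 (by omega)⟩

end IsWordSet

/-! ### Normal frames and the standard word set -/

/-- The words `(h · D i)ᵢ` for `h` in the dual set and orthogonal to `x`. -/
def wordSet (T : Finset (Fin 6 → ZMod 3)) (x : Fin 6 → ZMod 3) (D : Fin 6 → Fin 6 → ZMod 3) :
    Finset (Fin 6 → ZMod 3) :=
  (dualPerp T x).image fun h i => D i ⬝ᵥ h

theorem mem_wordSet {T : Finset (Fin 6 → ZMod 3)} {x : Fin 6 → ZMod 3}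
    {D : Fin 6 → Fin 6 → ZMod 3} {c : Fin 6 → ZMod 3} :
    c ∈ wordSet T x D ↔ ∃ h ∈ dualPerp T x, (fun i => D i ⬝ᵥ h) = c := by
  simp [wordSet]

theorem comp_mem_wordSet {T : Finset (Fin 6 → ZMod 3)} {x : Fin 6 → ZMod 3}
    {D : Fin 6 → Fin 6 → ZMod 3} {σ : Equiv.Perm (Fin 6)} {c : Fin 6 → ZMod 3} :
    c ∘ σ ∈ wordSet T x (D ∘ σ) ↔ c ∈ wordSet T x D := by
  rw [mem_wordSet, mem_wordSet]
  refine exists_congr fun h => and_congr_right fun _ => ?_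
  exact ⟨fun e => σ.surjective.injective_comp_right e, fun e => by rw [← e]; rfl⟩

/-- A frame whose vectors are normalized such that their sum is a multiple of `x`. -/
structure IsNormalFrame (T : Finset (Fin 6 → ZMod 3)) (x : Fin 6 → ZMod 3)
    (D : Fin 6 → Fin 6 → ZMod 3) : Prop extends IsFrame T x D where
  exists_sum_eq_smul : ∃ b : ZMod 3, ∑ i, D i = b • x

/-- The cyclic permutations of `{0, 1, 2}` and of `{3, 4, 5}`. -/
def cyclicIndex : Fin 6 → Fin 6 := ![1, 2, 0, 4, 5, 3]

/-- The word set of a frame, in its standard form. -/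
def stdWords : Finset (Fin 6 → ZMod 3) :=
  (fullWords.filter fun c => c ≠ halfWord ∧ c ≠ -halfWord) ∪
    Finset.univ.biUnion fun i => {unitWord i (cyclicIndex i), -unitWord i (cyclicIndex i)}

namespace IsNormalFrame

variable {T : Finset (Fin 6 → ZMod 3)} {x : Fin 6 → ZMod 3} {D : Fin 6 → Fin 6 → ZMod 3}

theorem comp (hF : IsNormalFrame T x D) (σ : Equiv.Perm (Fin 6)) : IsNormalFrame T x (D ∘ σ) :=
  ⟨hF.toIsFrame.comp σ, by
    obtain ⟨b, hb⟩ := hF.exists_sum_eq_smul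
    exact ⟨b, by rw [← hb]; exact Equiv.sum_comp σ D⟩⟩

theorem card_filter_wordSet (hF : IsNormalFrame T x D) (p : (Fin 6 → ZMod 3) → Prop)
    [DecidablePred p] :
    ((wordSet T x D).filter p).card
      = ((dualPerp T x).filter fun h => p fun i => D i ⬝ᵥ h).card := by
  rw [wordSet, Finset.filter_image, Finset.card_image_of_injOn]
  exact hF.word_injOn.mono (Finset.coe_subset.mpr (Finset.filter_subset _ _))

theorem isWordSet (hF : IsNormalFrame T x D) : IsWordSet (wordSet T x D) where
  neg_mem c hc := by
    obtain ⟨h, hh, rfl⟩ := mem_wordSet.mp hc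
    refine mem_wordSet.mpr ⟨-h, ?_, by funext i; simp⟩
    rw [dualPerp, Finset.mem_filter] at hh ⊢
    exact ⟨neg_mem_dualSet hh.1, by simp [hh.2]⟩
  sum_eq c hc := by
    obtain ⟨h, hh, rfl⟩ := mem_wordSet.mp hc
    obtain ⟨b, hb⟩ := hF.exists_sum_eq_smul
    rw [dualPerp, Finset.mem_filter] at hh
    rw [← sum_dotProduct, hb, smul_dotProduct, hh.2, smul_zero]
  zero_unique c hc i j hi hj := by
    obtain ⟨h, hh, rfl⟩ := mem_wordSet.mp hc
    exact hF.zero_unique hh hi hj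
  card_eq := by
    rw [wordSet, Finset.card_image_of_injOn hF.word_injOn, hF.card_dualPerp]
  card_zero i := by
    rw [hF.card_filter_wordSet fun c => c i = 0]
    exact hF.card_zero i
  card_pair i j hij := by
    rw [hF.card_filter_wordSet fun c => c i = c j]
    simpa using hF.card_pair hij (a := 1) (b := 1) one_ne_zero one_ne_zero

theorem eq_stdWords (hF : IsNormalFrame T x D) (hh : halfWord ∉ wordSet T x D)
    (h0 : unitWord 0 1 ∈ wordSet T x D) (h3 : unitWord 3 4 ∈ wordSet T x D) :
    wordSet T x D = stdWords := by
  have hΩ := hF.isWordSet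
  choose j hne hj using hΩ.exists_unitWord
  have hj0 : j 0 = 1 := by
    have : unitWord 0 1 ∈ (wordSet T x D).filter fun c => c 0 = 0 :=
      Finset.mem_filter.mpr ⟨h0, rfl⟩
    rw [hj 0] at this
    have key : ∀ k, unitWord 0 1 ∈ ({unitWord 0 k, -unitWord 0 k} : Finset _) → k ≠ 0 → k = 1 := by
      decide +kernel
    exact key _ this (hne 0)
  have hj3 : j 3 = 4 := by
    have : unitWord 3 4 ∈ (wordSet T x D).filter fun c => c 3 = 0 :=
      Finset.mem_filter.mpr ⟨h3, rfl⟩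
    rw [hj 3] at this
    have key : ∀ k, unitWord 3 4 ∈ ({unitWord 3 k, -unitWord 3 k} : Finset _) → k ≠ 3 → k = 4 := by
      decide +kernel
    exact key _ this (hne 3)
  have hcyc : j = cyclicIndex := by
    obtain ⟨c1, c2⟩ := hΩ.cyclic hh hne hj
    rw [hj0] at c1
    rw [hj3] at c2
    have c1' := c1.resolve_right fun h => absurd h.1 (by decide)
    have c2' := c2.resolve_right fun h => absurd h.1 (by decide)
    funext i
    fin_cases i
    · exact hj0
    · exact c1'.2.1
    · exact c1'.2.2
    · exact hj3
    · exact c2'.2.1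
    · exact c2'.2.2
  subst hcyc
  ext c
  rw [stdWords, Finset.mem_union]
  by_cases hc : ∀ i, c i ≠ 0
  · rw [hΩ.mem_iff_of_halfWord hh hc]
    refine ⟨Or.inl, fun h => h.resolve_right fun h' => ?_⟩
    obtain ⟨i, -, hi⟩ := Finset.mem_biUnion.mp h'
    rw [← hj i, Finset.mem_filter] at hi
    exact hc i hi.2
  · constructor
    · intro h
      push Not at hc
      obtain ⟨i, hi⟩ := hc
      refine Or.inr (Finset.mem_biUnion.mpr ⟨i, Finset.mem_univ _, ?_⟩)
      rw [← hj i]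
      exact Finset.mem_filter.mpr ⟨h, hi⟩
    · rintro (h | h)
      · simp only [Finset.mem_filter, fullWords, Finset.mem_univ, true_and] at h
        exact absurd h.1.1 hc
      · obtain ⟨i, -, hi⟩ := Finset.mem_biUnion.mp h
        rw [← hj i, Finset.mem_filter] at hi
        exact hi.1

theorem exists_unitWord_mem (hF : IsNormalFrame T x D) (hh : halfWord ∉ wordSet T x D) :
    (unitWord 0 1 ∈ wordSet T x D ∨ unitWord 0 2 ∈ wordSet T x D) ∧
      (unitWord 3 4 ∈ wordSet T x D ∨ unitWord 3 5 ∈ wordSet T x D) := by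
  have hΩ := hF.isWordSet
  choose j hne hj using hΩ.exists_unitWord
  have hmem : ∀ i, unitWord i (j i) ∈ wordSet T x D := by
    intro i
    have : unitWord i (j i) ∈ (wordSet T x D).filter fun c => c i = 0 := by rw [hj i]; simp
    exact (Finset.mem_filter.mp this).1
  obtain ⟨c1, c2⟩ := hΩ.cyclic hh hne hj
  constructor
  · rcases c1 with h | h
    · left; rw [← h.1]; exact hmem 0
    · right; rw [← h.1]; exact hmem 0
  · rcases c2 with h | h
    · left; rw [← h.1]; exact hmem 3
    · right; rw [← h.1]; exact hmem 3

end IsNormalFrame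

/-- A first relabelling makes `halfWord` the missing word. The transpositions (1 2) and (4 5) fix
`halfWord` and reverse the two 3-cycles independently, so both can be given the standard direction.
-/
theorem IsPartialDiffSet.exists_stdWords {T : Finset (Fin 6 → ZMod 3)}
    (hT : IsPartialDiffSet T) : ∃ x D, IsNormalFrame T x D ∧ wordSet T x D = stdWords := by
  obtain ⟨x, D₀, hF₀⟩ := hT.exists_isFrame
  obtain ⟨D₁, hF₁, hs⟩ := hF₀.exists_sum_eq
  have hN₁ : IsNormalFrame T x D₁ := ⟨hF₁, hs⟩
  obtain ⟨σ, hσ⟩ := hN₁.isWordSet.exists_perm_halfWord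
  obtain ⟨D₂, hN₂, hh₂⟩ : ∃ D, IsNormalFrame T x D ∧ halfWord ∉ wordSet T x D := by
    refine ⟨_, hN₁.comp σ, fun h => ?_⟩
    have e : halfWord = (halfWord ∘ σ.symm) ∘ σ := by funext i; simp
    rw [e, comp_mem_wordSet] at h
    exact hσ _ h (by funext i; simp)
  obtain ⟨D₃, hN₃, hh₃, h0₃⟩ : ∃ D, IsNormalFrame T x D ∧ halfWord ∉ wordSet T x D ∧
      unitWord 0 1 ∈ wordSet T x D := by
    rcases (hN₂.exists_unitWord_mem hh₂).1 with h | h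
    · exact ⟨D₂, hN₂, hh₂, h⟩
    · refine ⟨_, hN₂.comp (Equiv.swap 1 2), ?_, ?_⟩
      · have e : halfWord = halfWord ∘ Equiv.swap (1 : Fin 6) 2 := by decide +kernel
        rwa [e, comp_mem_wordSet]
      · have e : unitWord 0 1 = unitWord 0 2 ∘ Equiv.swap (1 : Fin 6) 2 := by decide +kernel
        rwa [e, comp_mem_wordSet]
  rcases (hN₃.exists_unitWord_mem hh₃).2 with h | h
  · exact ⟨x, D₃, hN₃, hN₃.eq_stdWords hh₃ h0₃ h⟩
  · refine ⟨x, _, hN₃.comp (Equiv.swap 4 5), (hN₃.comp _).eq_stdWords ?_ ?_ ?_⟩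
    · have e : halfWord = halfWord ∘ Equiv.swap (4 : Fin 6) 5 := by decide +kernel
      rwa [e, comp_mem_wordSet]
    · have e : unitWord 0 1 = unitWord 0 1 ∘ Equiv.swap (4 : Fin 6) 5 := by decide +kernel
      rwa [e, comp_mem_wordSet]
    · have e : unitWord 3 4 = unitWord 3 5 ∘ Equiv.swap (4 : Fin 6) 5 := by decide +kernel
      rwa [e, comp_mem_wordSet]

/-! ### The exhaustive search for lifts -/

namespace LiftSearch

/-- A point of the search: a vector over `𝔽₃`, whether it has two lifts instead of one, and whether
its lift (or the value that is not a lift) is normalized to be zero. -/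
structure Point where
  vec : List ℕ
  dbl : Bool
  base : Bool

/-- The hyperplanes used in the search. -/
def hyps : List (List ℕ) :=
  [[1,1,1,0,2], [1,1,1,1,0], [1,1,1,1,1], [1,1,2,1,2], [1,1,2,2,1], [1,1,2,2,2], [1,2,0,2,2],
    [1,2,1,1,2], [1,2,2,1,1]]

/-- The points, in the order in which the search visits them. -/
def points : List Point :=
  [⟨[1,1,2,0,0], false, true⟩, ⟨[0,1,2,1,2], false, true⟩, ⟨[1,2,2,0,2], false, true⟩,
    ⟨[1,1,0,0,1], false, true⟩, ⟨[1,1,1,0,2], false, false⟩, ⟨[1,1,2,2,2], false, false⟩,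
    ⟨[1,1,0,2,0], false, false⟩, ⟨[1,2,2,1,1], false, true⟩, ⟨[1,0,2,1,2], false, false⟩,
    ⟨[1,2,2,2,1], false, false⟩, ⟨[1,2,0,2,2], false, false⟩, ⟨[1,2,1,0,1], false, false⟩,
    ⟨[1,2,1,1,2], false, false⟩, ⟨[0,0,1,1,2], false, false⟩, ⟨[1,1,0,2,1], false, false⟩,
    ⟨[0,1,2,0,1], false, false⟩, ⟨[0,1,1,2,0], false, false⟩, ⟨[1,0,1,1,0], false, false⟩,
    ⟨[0,0,1,0,0], true, false⟩, ⟨[1,0,0,2,2], false, false⟩, ⟨[0,1,1,0,2], false, false⟩,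
    ⟨[0,1,0,1,1], false, false⟩, ⟨[1,1,2,1,2], false, false⟩, ⟨[1,0,1,0,1], false, false⟩,
    ⟨[0,0,1,2,2], false, false⟩, ⟨[0,1,0,2,2], false, false⟩, ⟨[1,2,0,0,1], false, false⟩,
    ⟨[0,0,0,0,1], true, false⟩, ⟨[0,1,1,1,0], false, false⟩, ⟨[1,2,1,2,2], false, false⟩,
    ⟨[1,1,0,1,0], false, false⟩, ⟨[1,2,2,2,0], false, false⟩, ⟨[1,2,0,1,0], false, false⟩,
    ⟨[0,1,2,2,1], false, false⟩, ⟨[1,0,1,2,1], false, false⟩, ⟨[1,1,1,2,2], false, false⟩,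
    ⟨[1,2,2,0,0], false, false⟩, ⟨[1,0,2,0,2], false, false⟩, ⟨[1,0,2,2,1], false, false⟩,
    ⟨[1,2,0,2,1], false, false⟩, ⟨[0,1,1,0,1], false, false⟩, ⟨[1,0,2,2,0], false, false⟩,
    ⟨[1,2,0,1,2], false, false⟩, ⟨[1,1,2,0,1], false, false⟩, ⟨[1,1,1,2,0], false, false⟩,
    ⟨[1,0,0,1,2], false, false⟩, ⟨[0,0,0,1,0], true, false⟩, ⟨[0,0,1,1,1], false, false⟩,
    ⟨[1,2,1,1,0], false, false⟩, ⟨[1,1,1,1,1], true, false⟩, ⟨[0,1,1,2,1], false, false⟩,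
    ⟨[1,1,0,0,2], false, false⟩]

/-- The functionals used in the search. -/
def funcs : List (List ℕ) :=
  [0, 1, 2].flatMap fun a => [0, 1, 2].flatMap fun b => [0, 1, 2].flatMap fun c =>
    [0, 1, 2].map fun d => [0, a, b, c, d]

/-- The dot product of two lists. -/
def dot : List ℕ → List ℕ → ℕ
  | a :: as, b :: bs => a * b + dot as bs
  | _, _ => 0

/-- The number with the given digits in base `b`, least significant digit first. -/
def pack (b : ℕ) (l : List ℕ) : ℕ := l.foldr (fun a r => a + b * r) 0

/-- Is the value `-g · p` a lift of `p`, if `l` is the special value of `p`? -/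
def liftBit (q : Point) (l : ℕ) (g : List ℕ) : ℕ :=
  bif Bool.xor q.dbl (Nat.beq ((dot g q.vec + l) % 3) 0) then 1 else 0

/-- Is the point in the hyperplane `h`? -/
def planeBit (q : Point) (h : List ℕ) : ℕ := bif Nat.beq (dot h q.vec % 3) 0 then 1 else 0

/-- The contribution of a point to all the counters, one hexadecimal digit for each counter. -/
def mask (q : Point) (l : ℕ) : ℕ :=
  pack (16 ^ 9) (funcs.map (liftBit q l)) * pack 16 (hyps.map (planeBit q))

/-- The overflow bits of all the counters. -/
def overflow : ℕ := pack (16 ^ 9) (funcs.map fun _ => pack 16 (hyps.map fun _ => 8))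

/-- Continue with a number in normal form: in the kernel, the recursor evaluates the number. -/
noncomputable def force {α : Type} (n : ℕ) (k : ℕ → α) : α :=
  Nat.rec (k 0) (fun m _ => k m) (Nat.add n 1)

/-- Depth-first search: `search T ls s` is true if each way to choose a member from each of the
lists leads to a partial sum (starting with `s`) that meets `T`. Written with recursors such that
the kernel evaluates each partial sum once. -/
noncomputable def search (T : ℕ) (ls : List (List ℕ)) : ℕ → Bool :=
  List.rec (fun _ => false) (fun ms _ k s => List.rec true (fun m _ r =>
    Nat.rec true (fun s' _ => Bool.rec r (Bool.rec false r (k s')) (Nat.beq (Nat.land s' T) 0))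
      (Nat.add (Nat.add s m) 1)) ms) ls

/-- Continue with the values of `f` on a list, in normal form. -/
noncomputable def forceMap (f : ℕ → ℕ) (vs : List ℕ) : (List ℕ → Bool) → Bool :=
  List.rec (fun k => k []) (fun v _ ih k => force (f v) fun m => ih fun ms => k (m :: ms)) vs

/-- The search with the lists of masks of the given points put in front of `acc`; each point comes
with the list of the special values that are allowed for it. -/
noncomputable def build (T : ℕ) (ps : List (Point × List ℕ)) : List (List ℕ) → Bool :=
  List.rec (fun acc => search T acc 0) (fun c _ k acc =>
    forceMap (mask c.1) c.2 fun ms => k (ms :: acc)) ps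

/-- The allowed special values of the points, with those of two of the points prescribed. -/
def choices (a b : ℕ) : List (Point × List ℕ) :=
  points.zipIdx.map fun c => (c.1, bif c.1.base then [0] else bif Nat.beq c.2 4 then [a] else
    bif Nat.beq c.2 5 then [b] else [0, 1, 2])

theorem force_eq {α : Type} (n : ℕ) (k : ℕ → α) : force n k = k n := rfl

theorem forceMap_eq (f : ℕ → ℕ) (vs : List ℕ) (k : List ℕ → Bool) :
    forceMap f vs k = k (vs.map f) := by
  induction vs generalizing k with
  | nil => rfl
  | cons v vs ih => exact ih fun ms => k (f v :: ms)

theorem build_eq (T : ℕ) (ps : List (Point × List ℕ)) (acc : List (List ℕ)) :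
    build T ps acc = search T ((ps.reverse.map fun c => c.2.map (mask c.1)) ++ acc) 0 := by
  induction ps generalizing acc with
  | nil => rfl
  | cons c ps ih =>
    have : build T (c :: ps) acc = forceMap (mask c.1) c.2 fun ms => build T ps (ms :: acc) := rfl
    rw [this, forceMap_eq, ih]
    simp

theorem map_fst_choices (a b : ℕ) : (choices a b).map Prod.fst = points := rfl

theorem search_cons {T : ℕ} {ms : List ℕ} {ls : List (List ℕ)} {s m : ℕ}
    (h : search T (ms :: ls) s = true) (hm : m ∈ ms) (hT : (s + m) &&& T = 0) :
    search T ls (s + m) = true := by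
  induction ms with
  | nil => simp at hm
  | cons a ms ih =>
    have e : search T ((a :: ms) :: ls) s = Bool.rec (search T (ms :: ls) s)
        (Bool.rec false (search T (ms :: ls) s) (search T ls (s + a)))
        (Nat.beq ((s + a) &&& T) 0) := rfl
    rw [e] at h
    rcases List.mem_cons.mp hm with rfl | hm
    · have h0 : Nat.beq ((s + m) &&& T) 0 = true := by rw [hT]; rfl
      rw [h0] at h
      cases h1 : search T ls (s + m)
      · rw [h1] at h; simp at h
      · rfl
    · refine ih ?_ hm
      cases h0 : Nat.beq ((s + a) &&& T) 0
      · rw [h0] at h; exact h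
      · rw [h0] at h
        cases h1 : search T ls (s + a)
        · rw [h1] at h; simp at h
        · rw [h1] at h; exact h

/-- Soundness of the search: along a choice whose partial sums never meet `T` the recursion reaches
the end of the lists, where the value is `false`. -/
theorem search_eq_false {α : Type} {T : ℕ} (f : α → List ℕ) (c : α → ℕ) (qs : List α) (s : ℕ)
    (hc : ∀ q ∈ qs, c q ∈ f q)
    (hT : ∀ l, l <+: qs → (s + (l.map c).sum) &&& T = 0) : search T (qs.map f) s = false := by
  induction qs generalizing s with
  | nil => rfl
  | cons q qs ih =>
    by_contra h
    rw [Bool.not_eq_false, List.map_cons] at h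
    have h1 := search_cons h (hc q (by simp)) (by simpa using hT [q] (by simp))
    rw [ih (s + c q) (fun q' hq' => hc q' (by simp [hq']))] at h1
    · simp at h1
    · intro l hl
      have := hT (q :: l) (by simpa using hl)
      simpa [add_assoc] using this

theorem pack_map_mul {α : Type} (b s : ℕ) (l : List α) (a : α → ℕ) :
    pack b (l.map a) * s = pack b (l.map fun x => a x * s) := by
  induction l with
  | nil => simp [pack]
  | cons x l ih => simp only [pack, List.map_cons, List.foldr_cons] at ih ⊢; rw [← ih]; ring

theorem mul_pack_map {α : Type} (b s : ℕ) (l : List α) (a : α → ℕ) :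
    s * pack b (l.map a) = pack b (l.map fun x => s * a x) := by
  rw [mul_comm, pack_map_mul]; simp only [mul_comm]

theorem pack_map_zero {α : Type} (b : ℕ) (l : List α) : pack b (l.map fun _ => 0) = 0 := by
  induction l with
  | nil => rfl
  | cons x l ih => simp only [pack, List.map_cons, List.foldr_cons] at ih ⊢; rw [ih]; simp

theorem pack_map_add {α : Type} (b : ℕ) (l : List α) (a a' : α → ℕ) :
    pack b (l.map a) + pack b (l.map a') = pack b (l.map fun x => a x + a' x) := by
  induction l with
  | nil => rfl
  | cons x l ih => simp only [pack, List.map_cons, List.foldr_cons] at ih ⊢; rw [← ih]; ring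

theorem sum_pack_map {α β : Type} (b : ℕ) (l : List α) (a : β → α → ℕ) (qs : List β) :
    (qs.map fun q => pack b (l.map (a q))).sum
      = pack b (l.map fun x => (qs.map fun q => a q x).sum) := by
  induction qs with
  | nil => exact (pack_map_zero b l).symm
  | cons q qs ih => simp only [List.map_cons, List.sum_cons, ih, pack_map_add]

theorem pack_map_lt {α : Type} {b : ℕ} {l : List α} {a : α → ℕ} (h : ∀ x ∈ l, a x < b) :
    pack b (l.map a) < b ^ l.length := by
  induction l with
  | nil => simp [pack]
  | cons x l ih =>
    have h1 := ih fun y hy => h y (by simp [hy])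
    have h2 := h x (by simp)
    simp only [pack, List.map_cons, List.foldr_cons, List.length_cons] at h1 ⊢
    calc _ < b + b * (l.map a).foldr (fun a r => a + b * r) 0 := by omega
      _ = b * ((l.map a).foldr (fun a r => a + b * r) 0 + 1) := by ring
      _ ≤ b * b ^ l.length := Nat.mul_le_mul_left _ h1
      _ = _ := by ring

theorem land_add_mul_two_pow {m a b r q : ℕ} (ha : a < 2 ^ m) (hb : b < 2 ^ m)
    (hab : a &&& b = 0) (hrq : r &&& q = 0) : (a + 2 ^ m * r) &&& (b + 2 ^ m * q) = 0 := by
  have h1 : ((a + 2 ^ m * r) &&& (b + 2 ^ m * q)) % 2 ^ m = 0 := by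
    rw [Nat.and_mod_two_pow, Nat.add_mul_mod_self_left, Nat.add_mul_mod_self_left,
      Nat.mod_eq_of_lt ha, Nat.mod_eq_of_lt hb, hab]
  have h2 : ((a + 2 ^ m * r) &&& (b + 2 ^ m * q)) / 2 ^ m = 0 := by
    rw [Nat.and_div_two_pow, Nat.add_mul_div_left _ _ (by positivity),
      Nat.add_mul_div_left _ _ (by positivity), Nat.div_eq_of_lt ha, Nat.div_eq_of_lt hb,
      zero_add, zero_add, hrq]
  rw [← Nat.div_add_mod ((a + 2 ^ m * r) &&& (b + 2 ^ m * q)) (2 ^ m), h1, h2]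
  simp

theorem land_pack_map {α : Type} (m : ℕ) {l : List α} {a b : α → ℕ} (ha : ∀ x ∈ l, a x < 2 ^ m)
    (hb : ∀ x ∈ l, b x < 2 ^ m) (hab : ∀ x ∈ l, a x &&& b x = 0) :
    pack (2 ^ m) (l.map a) &&& pack (2 ^ m) (l.map b) = 0 := by
  induction l with
  | nil => simp [pack]
  | cons x l ih =>
    simp only [pack, List.map_cons, List.foldr_cons] at ih ⊢
    exact land_add_mul_two_pow (ha x (by simp)) (hb x (by simp)) (hab x (by simp))
      (ih (fun y hy => ha y (by simp [hy])) (fun y hy => hb y (by simp [hy]))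
        fun y hy => hab y (by simp [hy]))

/-- The number of points of `qs` in the hyperplane `h` for which `-g · p` is a lift. -/
def count (F : Point → ℕ) (qs : List Point) (g h : List ℕ) : ℕ :=
  (qs.map fun q => liftBit q (F q) g * planeBit q h).sum

/-- A functional owns a block of nine hexadecimal digits, one for each hyperplane, so the product of
the two packed numbers in `mask` has the products of bits as digits, and adding masks adds all
counters at once. -/
theorem sum_mask (F : Point → ℕ) (qs : List Point) :
    (qs.map fun q => mask q (F q)).sum
      = pack (2 ^ 36) (funcs.map fun g => pack (2 ^ 4) (hyps.map (count F qs g))) := by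
  have e : ∀ q, mask q (F q)
      = pack (2 ^ 36) (funcs.map fun g => pack (2 ^ 4)
          (hyps.map fun h => liftBit q (F q) g * planeBit q h)) := by
    intro q
    rw [mask, pack_map_mul]
    simp only [mul_pack_map]
    norm_num
  simp only [e, sum_pack_map]
  rfl

/-- A counter of at most 7 fits below the bit of weight 8 of its digit, so no carry occurs and no
overflow bit is set. -/
theorem land_overflow {F : Point → ℕ} {qs : List Point}
    (h : ∀ g ∈ funcs, ∀ h ∈ hyps, count F qs g h ≤ 7) :
    (qs.map fun q => mask q (F q)).sum &&& overflow = 0 := by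
  have e : overflow = pack (2 ^ 36) (funcs.map fun _ => pack (2 ^ 4) (hyps.map fun _ => 8)) := by
    rw [overflow]; norm_num
  have hlen : ((2 : ℕ) ^ 4) ^ hyps.length = 2 ^ 36 := rfl
  rw [sum_mask, e]
  refine land_pack_map 36 (fun g hg => ?_) (fun g _ => ?_) fun g hg => ?_
  · rw [← hlen]
    exact pack_map_lt fun x hx => (h g hg x hx).trans_lt (by norm_num)
  · rw [← hlen]
    exact pack_map_lt fun x hx => by norm_num
  · refine land_pack_map 4 (fun x hx => (h g hg x hx).trans_lt (by norm_num))
      (fun x _ => by norm_num) fun x hx => ?_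
    have := h g hg x hx
    generalize count F qs g x = n at this
    interval_cases n <;> rfl

theorem count_mono {F : Point → ℕ} {l qs : List Point} (hl : l <+: qs) (g h : List ℕ) :
    count F l g h ≤ count F qs g h := by
  obtain ⟨t, rfl⟩ := hl
  simp [count]

/-- The search with all the points, for given special values of two of them. -/
noncomputable def run (a b : ℕ) : Bool :=
  force overflow fun T => build T (choices a b).reverse []

-- Fixing the special values of the points at positions 4 and 5 (counted from 0) splits the search
-- into nine separate kernel evaluations.
set_option maxHeartbeats 20000000 in
theorem run_eq_true {a b : ℕ} (ha : a < 3) (hb : b < 3) : run a b = true := by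
  interval_cases a <;> interval_cases b <;> decide +kernel

/-- There are no special values for the points that vanish on the base points and such that at most
seven points of each hyperplane lie on the graph of each of the functionals. -/
theorem exists_count_gt (F : Point → ℕ) (hF : ∀ q, F q < 3) (hb : ∀ q ∈ points, q.base → F q = 0) :
    ∃ g ∈ funcs, ∃ h ∈ hyps, 7 < count F points g h := by
  by_contra! hcon
  obtain ⟨q₄, h₄⟩ : ∃ q, points[4]? = some q := ⟨_, rfl⟩
  obtain ⟨q₅, h₅⟩ : ∃ q, points[5]? = some q := ⟨_, rfl⟩
  have h := run_eq_true (hF q₄) (hF q₅)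
  rw [run, force_eq, build_eq, List.reverse_reverse, List.append_nil,
    search_eq_false (fun c : Point × List ℕ => c.2.map (mask c.1))
      fun c => mask c.1 (F c.1)] at h
  · simp at h
  · intro c hc
    obtain ⟨⟨q, i⟩, hq, rfl⟩ := List.mem_map.mp hc
    have hqi : points[i]? = some q := List.mem_zipIdx_iff_getElem?.mp hq
    have hqp : q ∈ points := List.fst_mem_of_mem_zipIdx hq
    refine List.mem_map_of_mem ?_
    have h3 := hF q
    dsimp only
    cases hqb : q.base
    · rw [cond_false]
      cases h4 : Nat.beq i 4
      · cases h5 : Nat.beq i 5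
        · generalize F q = n at h3
          interval_cases n <;> simp
        · obtain rfl := Nat.eq_of_beq_eq_true h5
          rw [Option.some_injective _ (hqi.symm.trans h₅)]
          exact List.mem_singleton_self _
      · obtain rfl := Nat.eq_of_beq_eq_true h4
        rw [Option.some_injective _ (hqi.symm.trans h₄)]
        exact List.mem_singleton_self _
    · simp [hb q hqp hqb]
  · intro l hl
    rw [zero_add]
    have hl' := hl.map Prod.fst
    rw [map_fst_choices] at hl'
    have := land_overflow fun g hg h hh => (count_mono hl' g h).trans (hcon g hg h hh)
    rwa [List.map_map] at this

end LiftSearch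

/-! ### From a normal frame to the search -/

/-- The vector over `𝔽₃` given by a list. -/
def listVec (l : List ℕ) : Fin 5 → ZMod 3 := fun i => (l.getD i 0 : ℕ)

/-- The sixth coordinate is determined by the condition that the coordinates have sum zero. -/
def extendWord (c : Fin 5 → ZMod 3) : Fin 6 → ZMod 3 := Fin.snoc c (-∑ i, c i)

/-- The combination of the first five vectors of a frame with the given coefficients. -/
def frameVec (D : Fin 6 → Fin 6 → ZMod 3) (p : Fin 5 → ZMod 3) : Fin 6 → ZMod 3 :=
  ∑ i, p i • D i.castSucc

theorem frameVec_sub (D : Fin 6 → Fin 6 → ZMod 3) (p p' : Fin 5 → ZMod 3) :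
    frameVec D (p - p') = frameVec D p - frameVec D p' := by
  simp [frameVec, sub_smul]

theorem frameVec_neg (D : Fin 6 → Fin 6 → ZMod 3) (p : Fin 5 → ZMod 3) :
    frameVec D (-p) = -frameVec D p := by
  simp [frameVec]

theorem frameVec_dotProduct (D : Fin 6 → Fin 6 → ZMod 3) (p : Fin 5 → ZMod 3)
    (h : Fin 6 → ZMod 3) : frameVec D p ⬝ᵥ h = ∑ i, p i * (D i.castSucc ⬝ᵥ h) := by
  simp [frameVec, sum_dotProduct]

theorem IsFrame.eq_zero_of_frameVec_eq {T : Finset (Fin 6 → ZMod 3)} {x : Fin 6 → ZMod 3}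
    {D : Fin 6 → Fin 6 → ZMod 3} (hF : IsFrame T x D) {p : Fin 5 → ZMod 3} {b : ZMod 3}
    (h : frameVec D p = b • x) : p = 0 := by
  by_contra hp
  refine hF.relation_ne_zero (a := Fin.snoc p (0 : ZMod 3)) (b := b) (fun h0 => hp ?_) ?_ 5 ?_
  · funext i
    simpa using congrFun h0 i.castSucc
  · rw [Fin.sum_univ_castSucc, ← h]
    simp only [Fin.snoc_castSucc, frameVec, Fin.snoc_last, zero_smul, add_zero]
  · exact Fin.snoc_last (α := fun _ => ZMod 3) _ _

/-- In the span of `h` and `G`, zero contributes 280, `±h` contribute -44 each, and each of the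
other six vectors at most 10; so 18 times the count is at most 252. -/
theorem IsPartialDiffSet.card_filter_le {T : Finset (Fin 6 → ZMod 3)} (hT : IsPartialDiffSet T)
    {x h G : Fin 6 → ZMod 3} (hh : h ∈ dualPerp T x) (hG : x ⬝ᵥ G = 1) :
    (T.filter fun w => h ⬝ᵥ w = 0 ∧ G ⬝ᵥ w = 0).card ≤ 14 := by
  rw [dualPerp, Finset.mem_filter] at hh
  have key := sum_charSum_span_pair T h G
  have e0 : charSum T 0 = 280 := by rw [charSum_zero, hT.card_eq]; norm_num
  have e1 : charSum T h = -44 := by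
    have := hh.1
    simp only [dualSet, Finset.mem_filter] at this
    exact this.2.2
  have e2 : ∀ a b : ZMod 3, b ≠ 0 → charSum T (a • h + b • G) ≤ 10 := by
    intro a b hb
    have hne : a • h + b • G ≠ 0 := by
      intro h0
      have := congrArg (fun w => x ⬝ᵥ w) h0
      simp only [dotProduct_add, dotProduct_smul, hh.2, hG, dotProduct_zero] at this
      exact hb (by simpa using this)
    rcases hT.charSum_eq_or hne with h' | h' <;> rw [h']
    norm_num
  have e3 : charSum T (-h) = -44 := by rw [charSum_neg, e1]
  simp only [ZMod.sum_three, ZMod.two_eq_neg_one_three] at key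
  have b1 := e2 0 1 (by decide)
  have b2 := e2 0 (-1) (by decide)
  have b3 := e2 1 1 (by decide)
  have b4 := e2 1 (-1) (by decide)
  have b5 := e2 (-1) 1 (by decide)
  have b6 := e2 (-1) (-1) (by decide)
  simp only [zero_smul, add_zero, zero_add, one_smul, neg_smul, e0, e1, e3] at key b1 b2 b3 b4 b5 b6
  omega

/-- For p ≠ 0 the vector `frameVec D p` is not a multiple of `x`, so the line count applies: 14, 8
or 2 words mean 0, 1 or 2 lifts. -/
theorem IsNormalFrame.card_lifts {T : Finset (Fin 6 → ZMod 3)} {x : Fin 6 → ZMod 3}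
    {D : Fin 6 → Fin 6 → ZMod 3} (hF : IsNormalFrame T x D) {p : Fin 5 → ZMod 3} (hp : p ≠ 0) :
    ((wordSet T x D).filter fun c => ∑ i, p i * c i.castSucc = 0).card
      + 6 * (Finset.univ.filter fun t : ZMod 3 => frameVec D p + t • x ∈ T).card = 14 := by
  rw [hF.card_filter_wordSet fun c => ∑ i : Fin 5, p i * c i.castSucc = 0,
    ← hF.pds.card_dualSet_filter_add hF.mem (v := frameVec D p), dualPerp, Finset.filter_filter]
  · simp only [frameVec_dotProduct]
  · intro t ht
    refine hp (hF.eq_zero_of_frameVec_eq (b := -t) ?_)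
    rw [neg_smul]
    exact eq_neg_of_add_eq_zero_left ht

namespace LiftSearch

/-- The base points. -/
def basePoint : Fin 5 → Fin 5 → ZMod 3 :=
  ![![1, 1, 2, 0, 0], ![0, 1, 2, 1, 2], ![1, 2, 2, 0, 2], ![1, 1, 0, 0, 1], ![1, 2, 2, 1, 1]]

/-- The inverse of the matrix with the rows `basePoint`. -/
def baseInverse : Matrix (Fin 5) (Fin 5) (ZMod 3) :=
  !![1, 2, 2, 0, 1; 2, 2, 1, 2, 1; 2, 1, 0, 2, 2; 0, 2, 2, 2, 2; 0, 2, 0, 2, 1]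

theorem basePoint_mul_baseInverse : Matrix.of basePoint * baseInverse = 1 := by decide +kernel

/-- The base points form a basis of 𝔽₃⁵, so a linear functional interpolates any values on them.
Subtracting it amounts to changing the `D i` by multiples of `x`. -/
theorem exists_functional_eq (f : (Fin 5 → ZMod 3) → ZMod 3) :
    ∃ l : Fin 5 → ZMod 3, ∀ q ∈ points, q.base → l ⬝ᵥ listVec q.vec = f (listVec q.vec) := by
  have hb : ∀ q ∈ points, q.base → ∃ i : Fin 5, listVec q.vec = basePoint i := by
    decide +kernel
  refine ⟨baseInverse.mulVec fun i => f (basePoint i), fun q hq hqb => ?_⟩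
  obtain ⟨i, hi⟩ := hb q hq hqb
  have := congrFun (Matrix.mulVec_mulVec (fun i => f (basePoint i)) (Matrix.of basePoint) baseInverse) i
  rw [basePoint_mul_baseInverse, Matrix.one_mulVec] at this
  rw [hi, dotProduct_comm, ← this]
  rfl

theorem vec_length : (∀ q ∈ points, q.vec.length = 5) ∧ (∀ g ∈ funcs, g.length = 5) ∧
    ∀ h ∈ hyps, h.length = 5 := by decide +kernel

theorem natCast_dot {a b : List ℕ} (ha : a.length = 5) (hb : b.length = 5) :
    (dot a b : ZMod 3) = listVec a ⬝ᵥ listVec b := by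
  match a, b, ha, hb with
  | [a₀, a₁, a₂, a₃, a₄], [b₀, b₁, b₂, b₃, b₄], _, _ =>
    simp [dot, listVec, dotProduct, Fin.sum_univ_five]
    ring

theorem extendWord_mem : ∀ h ∈ hyps, extendWord (listVec h) ∈ stdWords := by decide +kernel

theorem card_words : ∀ q ∈ points, listVec q.vec ≠ 0 ∧
    (stdWords.filter fun c => ∑ i, listVec q.vec i * c i.castSucc = 0).card
      = bif q.dbl then 2 else 8 := by decide +kernel

theorem points_distinct : ∀ i j : Fin points.length,
    (listVec (points.get i).vec = listVec (points.get j).vec → i = j) ∧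
      listVec (points.get i).vec ≠ -listVec (points.get j).vec := by decide +kernel

/-- Is `t` a lift of `q`, if `f` is the special value of `q`? -/
def IsLift (q : Point) (f t : ZMod 3) : Prop := if q.dbl then t ≠ f else t = f

theorem exists_isLift {q : Point} {L : ZMod 3 → Prop} [DecidablePred L]
    (h : (Finset.univ.filter L).card = bif q.dbl then 2 else 1) :
    ∃ f, ∀ t, L t ↔ IsLift q f t := by
  unfold IsLift
  cases hq : q.dbl
  · rw [hq, cond_false, Finset.card_eq_one] at h
    obtain ⟨f, hf⟩ := h
    refine ⟨f, fun t => ?_⟩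
    have := congrArg (t ∈ ·) hf
    simpa using this
  · have h2 : (Finset.univ.filter fun t => ¬ L t).card = 1 := by
      have := Finset.card_filter_add_card_filter_not (s := (Finset.univ : Finset (ZMod 3))) L
      rw [h, hq] at this
      simp only [cond_true, Finset.card_univ, ZMod.card] at this
      omega
    obtain ⟨f, hf⟩ := Finset.card_eq_one.mp h2
    refine ⟨f, fun t => ?_⟩
    have := congrArg (t ∈ ·) hf
    simp only [Finset.mem_filter, Finset.mem_univ, true_and, Finset.mem_singleton, eq_iff_iff]
      at this
    simp [← this]

theorem natCast_eq_zero_iff_beq (n : ℕ) : (n : ZMod 3) = 0 ↔ Nat.beq (n % 3) 0 = true := by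
  rw [ZMod.natCast_eq_zero_iff, Nat.dvd_iff_mod_eq_zero, Nat.beq_eq]

open scoped Classical in
theorem planeBit_eq {q : Point} {h : List ℕ} (hq : q.vec.length = 5) (hh : h.length = 5) :
    planeBit q h = if listVec h ⬝ᵥ listVec q.vec = 0 then 1 else 0 := by
  rw [← natCast_dot hh hq, planeBit]
  simp only [natCast_eq_zero_iff_beq]
  cases Nat.beq (dot h q.vec % 3) 0 <;> rfl

open scoped Classical in
theorem liftBit_eq {q : Point} {g : List ℕ} {l : ℕ} (hq : q.vec.length = 5) (hg : g.length = 5) :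
    liftBit q l g = if IsLift q (l : ZMod 3) (-(listVec g ⬝ᵥ listVec q.vec)) then 1 else 0 := by
  have e : -(listVec g ⬝ᵥ listVec q.vec) = (l : ZMod 3)
      ↔ Nat.beq ((dot g q.vec + l) % 3) 0 = true := by
    rw [← natCast_eq_zero_iff_beq, Nat.cast_add, natCast_dot hg hq, neg_eq_iff_add_eq_zero]
  simp only [liftBit, IsLift, ne_eq, e]
  cases q.dbl <;> cases Nat.beq ((dot g q.vec + l) % 3) 0 <;> rfl

end LiftSearch

open LiftSearch

namespace IsNormalFrame

variable {T : Finset (Fin 6 → ZMod 3)} {x : Fin 6 → ZMod 3} {D : Fin 6 → Fin 6 → ZMod 3}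

theorem exists_special (hF : IsNormalFrame T x D) (hW : wordSet T x D = stdWords) :
    ∃ f : (Fin 5 → ZMod 3) → ZMod 3, ∀ q ∈ points, ∀ t,
      frameVec D (listVec q.vec) + t • x ∈ T ↔ IsLift q (f (listVec q.vec)) t := by
  have h1 : ∀ i : Fin points.length, ∃ f, ∀ t,
      frameVec D (listVec (points.get i).vec) + t • x ∈ T ↔ IsLift (points.get i) f t := by
    intro i
    obtain ⟨hne, hc⟩ := card_words _ (List.get_mem points i)
    have h2 := hF.card_lifts hne
    rw [hW, hc] at h2
    refine exists_isLift ?_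
    cases hq : (points.get i).dbl
    · rw [hq] at h2; simp only [cond_false] at h2 ⊢; omega
    · rw [hq] at h2; simp only [cond_true] at h2 ⊢; omega
  choose f hf using h1
  classical
  -- The listed vectors are distinct, so the special value is a function of the vector; the default
  -- 0 elsewhere is never used.
  refine ⟨fun v => if h : ∃ i, listVec (points.get i).vec = v then f h.choose else 0,
    fun q hq t => ?_⟩
  obtain ⟨i, rfl⟩ := List.mem_iff_get.mp hq
  have h : ∃ j, listVec (points.get j).vec = listVec (points.get i).vec := ⟨i, rfl⟩
  beta_reduce
  rw [dif_pos h, (points_distinct _ _).1 h.choose_spec]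
  exact hf i t

/-- Take h in the dual set with word `extendWord c`, and G with x · G = 1 and Dᵢ · G = gᵢ. The lifts
in question and their negatives are orthogonal to both, and are all distinct because the points are
distinct up to sign; so twice their number is at most 14. -/
theorem card_lifts_on_plane (hF : IsNormalFrame T x D) (hW : wordSet T x D = stdWords)
    {c : Fin 5 → ZMod 3} (hc : extendWord c ∈ stdWords) (g : Fin 5 → ZMod 3)
    (s : Finset (Fin points.length))
    (hs : ∀ i ∈ s, c ⬝ᵥ listVec (points.get i).vec = 0 ∧
      frameVec D (listVec (points.get i).vec) + (-(g ⬝ᵥ listVec (points.get i).vec)) • x ∈ T) :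
    s.card ≤ 7 := by
  rw [← hW, mem_wordSet] at hc
  obtain ⟨h, hh, hc⟩ := hc
  obtain ⟨G, hG, hDG⟩ := hF.exists_functional g
  have hxh : x ⬝ᵥ h = 0 := (Finset.mem_filter.mp hh).2
  have hDh : ∀ i : Fin 5, D i.castSucc ⬝ᵥ h = c i := fun i => by
    have := congrFun hc i.castSucc
    rwa [extendWord, Fin.snoc_castSucc] at this
  set φ : Fin points.length → Fin 6 → ZMod 3 := fun i =>
    frameVec D (listVec (points.get i).vec) + (-(g ⬝ᵥ listVec (points.get i).vec)) • x with hφ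
  have hφS : ∀ i ∈ s, φ i ∈ T.filter fun w => h ⬝ᵥ w = 0 ∧ G ⬝ᵥ w = 0 := by
    intro i hi
    refine Finset.mem_filter.mpr ⟨(hs i hi).2, ?_, ?_⟩
    · rw [dotProduct_comm, hφ, add_dotProduct, smul_dotProduct, hxh, frameVec_dotProduct,
        smul_zero, add_zero, ← (hs i hi).1]
      exact Finset.sum_congr rfl fun k _ => by rw [hDh, mul_comm]
    · rw [dotProduct_comm, hφ, add_dotProduct, smul_dotProduct, hG, frameVec_dotProduct,
        smul_eq_mul, mul_one, add_neg_eq_zero]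
      exact Finset.sum_congr rfl fun k _ => by rw [hDG, mul_comm]
  have hinj : Function.Injective φ := by
    intro i j hij
    refine (points_distinct i j).1 (sub_eq_zero.mp (hF.eq_zero_of_frameVec_eq
      (b := g ⬝ᵥ listVec (points.get i).vec - g ⬝ᵥ listVec (points.get j).vec) ?_))
    rw [frameVec_sub, sub_smul]
    simp only [hφ, neg_smul] at hij
    linear_combination hij
  have hdisj : ∀ i j, φ i ≠ -φ j := by
    intro i j hij
    refine (points_distinct i j).2 (sub_eq_zero.mp (hF.eq_zero_of_frameVec_eq
      (b := g ⬝ᵥ listVec (points.get i).vec + g ⬝ᵥ listVec (points.get j).vec) ?_))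
    rw [frameVec_sub, frameVec_neg, add_smul]
    simp only [hφ, neg_smul] at hij
    linear_combination hij
  have hle : (s.image φ ∪ s.image fun i => -φ i).card ≤ 14 := by
    refine (Finset.card_le_card fun w hw => ?_).trans (hF.pds.card_filter_le hh hG)
    rcases Finset.mem_union.mp hw with hw | hw
    · obtain ⟨i, hi, rfl⟩ := Finset.mem_image.mp hw
      exact hφS i hi
    · obtain ⟨i, hi, rfl⟩ := Finset.mem_image.mp hw
      have := Finset.mem_filter.mp (hφS i hi)
      exact Finset.mem_filter.mpr ⟨hF.pds.neg_mem _ this.1, by simp [this.2.1], by simp [this.2.2]⟩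
  rw [Finset.card_union_of_disjoint, Finset.card_image_of_injective _ hinj,
    Finset.card_image_of_injective _ fun i j e => hinj (neg_injective e)] at hle
  · omega
  · rw [Finset.disjoint_left]
    intro w hw hw'
    obtain ⟨i, -, rfl⟩ := Finset.mem_image.mp hw
    obtain ⟨j, -, hj⟩ := Finset.mem_image.mp hw'
    exact hdisj i j hj.symm

end IsNormalFrame

theorem not_isPartialDiffSet (T : Finset (Fin 6 → ZMod 3)) : ¬ IsPartialDiffSet T := by
  intro hT
  obtain ⟨x, D, hF, hW⟩ := hT.exists_stdWords
  obtain ⟨f, hf⟩ := hF.exists_special hW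
  obtain ⟨l, hl⟩ := exists_functional_eq f
  -- The search sees special values reduced by `l`; for the unreduced values its functional `g`
  -- becomes `listVec g - l`.
  obtain ⟨g, hg, h, hh, hgt⟩ := exists_count_gt
    (fun q => (f (listVec q.vec) - l ⬝ᵥ listVec q.vec).val)
    (fun q => ZMod.val_lt _) (fun q hq hb => by simp [hl q hq hb])
  refine absurd hgt (not_lt.mpr ?_)
  classical
  rw [count, ← Fin.sum_univ_fun_getElem]
  refine le_trans (le_of_eq ?_) (hF.card_lifts_on_plane hW (extendWord_mem h hh) (listVec g - l)
    (Finset.univ.filter fun i => listVec h ⬝ᵥ listVec (points.get i).vec = 0 ∧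
      frameVec D (listVec (points.get i).vec)
        + (-((listVec g - l) ⬝ᵥ listVec (points.get i).vec)) • x ∈ T)
    fun i hi => (Finset.mem_filter.mp hi).2)
  rw [Finset.card_filter]
  refine Finset.sum_congr rfl fun i _ => ?_
  have hm := List.get_mem points i
  have hq := vec_length.1 _ hm
  change liftBit (points.get i) _ g * planeBit (points.get i) h = _
  rw [planeBit_eq hq (vec_length.2.2 h hh), liftBit_eq hq (vec_length.2.1 g hg),
    ZMod.natCast_zmod_val]
  simp only [hf _ hm]
  have e : IsLift (points.get i) (f (listVec (points.get i).vec) - l ⬝ᵥ listVec (points.get i).vec)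
      (-(listVec g ⬝ᵥ listVec (points.get i).vec)) ↔
      IsLift (points.get i) (f (listVec (points.get i).vec))
        (-((listVec g - l) ⬝ᵥ listVec (points.get i).vec)) := by
    simp only [IsLift, sub_dotProduct, neg_sub, ne_eq, eq_sub_iff_add_eq, neg_add_eq_sub]
  rw [← e]
  simp only [mul_ite, mul_one, mul_zero, ite_and]
  rfl

/-! ### Partial difference sets in an arbitrary space -/

/-- The dimension need not be assumed: counting pairs in `T` by their sum gives 140² + 17 · 140 = 30
· |W| + 110, hence |W| = 3⁶. -/
theorem false_of_partialDiffSet {W : Type*} [AddCommGroup W] [Module (ZMod 3) W] [Fintype W]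
    [DecidableEq W] {T : Finset W} (card_eq : T.card = 140) (neg_mem : ∀ w ∈ T, -w ∈ T)
    (zero_notMem : 0 ∉ T) (count_mem : ∀ v ∈ T, (T.filter fun w => v - w ∈ T).card = 13)
    (count_notMem : ∀ v ∉ T, v ≠ 0 → (T.filter fun w => v - w ∈ T).card = 30) : False := by
  have hW : Fintype.card W = 3 ^ 6 := by
    have h1 : ∑ v : W, (T.filter fun w => v - w ∈ T).card = 140 * 140 := by
      simp only [Finset.card_filter]
      rw [Finset.sum_comm]
      have : ∀ w ∈ T, ∑ v : W, (if v - w ∈ T then 1 else 0) = 140 := by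
        intro w _
        rw [← Equiv.sum_comp (Equiv.addRight w)]
        simp [card_eq]
      rw [Finset.sum_congr rfl this, Finset.sum_const, card_eq, smul_eq_mul]
    have h2 : ∀ v : W, (T.filter fun w => v - w ∈ T).card
        + 17 * (if v ∈ T then 1 else 0) = 30 + 110 * (if v = 0 then 1 else 0) := by
      intro v
      by_cases h0 : v = 0
      · subst h0
        rw [Finset.filter_true_of_mem fun w hw => by rw [zero_sub]; exact neg_mem w hw, card_eq,
          if_neg zero_notMem, if_pos rfl]
      · by_cases hv : v ∈ T
        · rw [count_mem v hv, if_pos hv, if_neg h0]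
        · rw [count_notMem v hv h0, if_neg hv, if_neg h0]
    have h3 := Finset.sum_congr rfl fun v (_ : v ∈ Finset.univ) => h2 v
    rw [Finset.sum_add_distrib, h1, Finset.sum_add_distrib, ← Finset.mul_sum, ← Finset.mul_sum] at h3
    simp [card_eq] at h3
    omega
  have hfr : Module.finrank (ZMod 3) W = Module.finrank (ZMod 3) (Fin 6 → ZMod 3) := by
    have := Module.card_eq_pow_finrank (K := ZMod 3) (V := W)
    rw [hW, ZMod.card] at this
    simpa using (Nat.pow_right_injective (le_refl _ |>.trans (by norm_num : 2 ≤ 3)) this).symm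
  let φ := LinearEquiv.ofFinrankEq W (Fin 6 → ZMod 3) hfr
  have hm : ∀ v, φ v ∈ T.map φ.toEquiv.toEmbedding ↔ v ∈ T := fun v =>
    Finset.mem_map' φ.toEquiv.toEmbedding
  have hcard : ∀ v, ((T.map φ.toEquiv.toEmbedding).filter fun w =>
      φ v - w ∈ T.map φ.toEquiv.toEmbedding).card = (T.filter fun w => v - w ∈ T).card := by
    intro v
    rw [Finset.filter_map, Finset.card_map]
    congr 1
    refine Finset.filter_congr fun w _ => ?_
    rw [← hm (v - w), map_sub]
    rfl
  refine not_isPartialDiffSet (T.map φ.toEquiv.toEmbedding) ⟨by rw [Finset.card_map, card_eq],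
    fun w hw => ?_, fun h => zero_notMem ?_, fun v hv => ?_, fun v hv hv0 => ?_⟩
  · obtain ⟨w, rfl⟩ := φ.surjective w
    rw [← map_neg, hm]
    exact neg_mem w ((hm w).mp hw)
  · rwa [← hm, map_zero]
  · obtain ⟨v, rfl⟩ := φ.surjective v
    rw [hcard]
    exact count_mem v ((hm v).mp hv)
  · obtain ⟨v, rfl⟩ := φ.surjective v
    rw [hcard]
    exact count_notMem v (fun h => hv ((hm v).mpr h)) fun h => hv0 (by rw [h, map_zero])

/-! ### The ternary Hamming graph and its coset quotients -/

section Hamming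

variable {n : ℕ}

/-- The vectors of weight one in `𝔽₃ⁿ`. -/
def weightOne (k : Fin n × (ZMod 3)ˣ) : Fin n → ZMod 3 := Pi.single k.1 (k.2 : ZMod 3)

theorem weightOne_neg (k : Fin n × (ZMod 3)ˣ) : weightOne (k.1, -k.2) = -weightOne k := by
  simp [weightOne, Pi.single_neg]

theorem weightOne_injective : Function.Injective (weightOne (n := n)) := by
  rintro ⟨i, s⟩ ⟨j, t⟩ h
  simp only [weightOne] at h
  have hij : i = j := by
    by_contra hij
    have := congrFun h i
    rw [Pi.single_eq_same, Pi.single_eq_of_ne hij] at this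
    exact s.ne_zero this
  subst hij
  exact Prod.ext rfl (Units.ext (Pi.single_injective i h))

theorem neighborSet_hammingGraph (v : Fin n → ZMod 3) :
    (hammingGraph n (ZMod 3)).neighborSet v = Set.range fun k => v + weightOne k := by
  ext w
  change hammingDist v w = 1 ↔ _
  rw [hammingDist, Finset.card_eq_one]
  constructor
  · rintro ⟨i, hi⟩
    have hi' : ∀ j, v j ≠ w j ↔ j = i := fun j => by
      have := congrArg (j ∈ ·) hi
      simpa using this
    refine ⟨(i, Units.mk0 (w i - v i) (sub_ne_zero.mpr ((hi' i).mpr rfl).symm)), ?_⟩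
    funext j
    by_cases hj : j = i
    · subst hj; simp [weightOne]
    · simp [weightOne, hj, not_not.mp (mt (hi' j).mp hj)]
  · rintro ⟨k, rfl⟩
    refine ⟨k.1, ?_⟩
    ext j
    simp [weightOne, Pi.single_apply]

theorem ncard_neighborSet_inter (v : Fin n → ZMod 3) (P : Set (Fin n → ZMod 3)) :
    ((hammingGraph n (ZMod 3)).neighborSet v ∩ P).ncard
      = Nat.card {k : Fin n × (ZMod 3)ˣ // v + weightOne k ∈ P} := by
  have hinj : Function.Injective fun k : Fin n × (ZMod 3)ˣ => v + weightOne k :=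
    fun _ _ h => weightOne_injective (add_left_cancel h)
  have : (hammingGraph n (ZMod 3)).neighborSet v ∩ P
      = (fun k => v + weightOne k) '' {k | v + weightOne k ∈ P} := by
    rw [neighborSet_hammingGraph]
    ext w
    constructor
    · rintro ⟨⟨k, rfl⟩, hk⟩; exact ⟨k, hk, rfl⟩
    · rintro ⟨k, hk, rfl⟩; exact ⟨⟨k, rfl⟩, hk⟩
  rw [this, Set.ncard_image_of_injective _ hinj]
  rfl

theorem ncard_neighborSet (v : Fin n → ZMod 3) :
    ((hammingGraph n (ZMod 3)).neighborSet v).ncard = 2 * n := by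
  have h := ncard_neighborSet_inter v Set.univ
  rw [Set.inter_univ] at h
  rw [h]
  simp only [Set.mem_univ, Nat.card_eq_fintype_card]
  rw [Fintype.card_subtype_true, Fintype.card_prod, Fintype.card_fin, mul_comm]
  rfl

/-- The translations, as automorphisms of the Hamming graph. -/
def translateIso (c : Fin n → ZMod 3) : hammingGraph n (ZMod 3) ≃g hammingGraph n (ZMod 3) where
  toEquiv := Equiv.addRight c
  map_rel_iff' {v w} := by
    change hammingDist (fun i => v i + c i) (fun i => w i + c i) = 1 ↔ hammingDist v w = 1
    rw [hammingDist_comp (fun i a => a + c i) fun i => add_left_injective (c i)]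

/-- The negation, as an automorphism of the Hamming graph. -/
def negIso : hammingGraph n (ZMod 3) ≃g hammingGraph n (ZMod 3) where
  toEquiv := Equiv.neg _
  map_rel_iff' {v w} := by
    change hammingDist (fun i => -v i) (fun i => -w i) = 1 ↔ hammingDist v w = 1
    rw [hammingDist_comp (fun _ a => -a) fun _ => neg_injective]

end Hamming

/-- The neighbours of v are the sums of v and a weight-one vector. Modulo `C` the weight-one vectors
form the set `T`, `P` is the preimage of `T`, and the neighbour counts 13 and 30 become the
difference counts of `T`. Both arrays reduce to this. -/
theorem false_of_neighbor_counts {n : ℕ} (hn : n = 70)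
    (C : Submodule (ZMod 3) (Fin n → ZMod 3)) (P : Set (Fin n → ZMod 3)) (hCP : ∀ v ∈ C, v ∉ P)
    (hC : ∀ v, v ∉ P → ((hammingGraph n (ZMod 3)).neighborSet v ∩ C).ncard = 0)
    (hP : ∀ v ∈ P, ((hammingGraph n (ZMod 3)).neighborSet v ∩ C).ncard = 1)
    (hPP : ∀ v ∈ P, ((hammingGraph n (ZMod 3)).neighborSet v ∩ P).ncard = 13)
    (hQP : ∀ v, v ∉ C → v ∉ P → ((hammingGraph n (ZMod 3)).neighborSet v ∩ P).ncard = 30) :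
    False := by
  classical
  simp only [ncard_neighborSet_inter] at hC hP hPP hQP
  have : Fintype ((Fin n → ZMod 3) ⧸ C) := Fintype.ofFinite _
  set π : (Fin n → ZMod 3) → (Fin n → ZMod 3) ⧸ C := fun v => Submodule.Quotient.mk v with hπ
  set κ : Fin n × (ZMod 3)ˣ → (Fin n → ZMod 3) ⧸ C := fun k => π (weightOne k) with hκ
  have πadd : ∀ v w, π (v + w) = π v + π w := fun _ _ => rfl
  have π0 : ∀ v, π v = 0 ↔ v ∈ C := fun v => Submodule.Quotient.mk_eq_zero C
  have κneg : ∀ k, κ (k.1, -k.2) = -κ k := fun k => by simp only [hκ, weightOne_neg]; rfl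
  set T := Finset.univ.image κ with hT
  have memT : ∀ {w}, w ∈ T ↔ ∃ k, κ k = w := by simp [hT]
  have negT : ∀ w ∈ T, -w ∈ T := by
    intro w hw
    obtain ⟨k, rfl⟩ := memT.mp hw
    exact memT.mpr ⟨_, κneg k⟩
  have hPT : ∀ v, v ∈ P ↔ π v ∈ T := by
    intro v
    constructor
    · intro hv
      have : Nonempty {k // v + weightOne k ∈ (C : Set (Fin n → ZMod 3))} := by
        by_contra hne
        rw [not_nonempty_iff] at hne
        simpa using hP v hv
      obtain ⟨k, hk⟩ := this
      have hk' : π v + κ k = 0 := (π0 (v + weightOne k)).mpr hk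
      rw [eq_neg_of_add_eq_zero_left hk']
      exact negT _ (memT.mpr ⟨k, rfl⟩)
    · intro hv
      obtain ⟨k, hk⟩ := memT.mp (negT _ hv)
      by_contra hvP
      have h0 := hC v hvP
      rw [Nat.card_eq_zero] at h0
      rcases h0 with h0 | h0
      · refine h0.false ⟨k, (π0 _).mp ?_⟩
        rw [πadd]
        change π v + κ k = 0
        rw [hk, add_neg_cancel]
      · exact (h0.not_finite inferInstance).elim
  -- If two weight-one vectors were congruent modulo `C`, the negative of one would have two
  -- neighbours in `C`.
  have κinj : Function.Injective κ := by
    intro a b hab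
    have hv : -weightOne a ∈ P := (hPT _).mpr (negT _ (memT.mpr ⟨a, rfl⟩))
    have h1 := hP _ hv
    rw [Nat.card_eq_one_iff_unique] at h1
    have := h1.1
    have hb : -weightOne a + weightOne b ∈ C := by
      rw [← π0, πadd]
      change -κ a + κ b = 0
      rw [hab, neg_add_cancel]
    have ha : -weightOne a + weightOne a ∈ C := by simp
    exact congrArg Subtype.val (Subsingleton.elim
      (⟨a, ha⟩ : {k // -weightOne a + weightOne k ∈ (C : Set (Fin n → ZMod 3))}) ⟨b, hb⟩)
  have cardT : T.card = 140 := by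
    rw [hT, Finset.card_image_of_injective _ κinj, Finset.card_univ, Fintype.card_prod,
      Fintype.card_fin, hn]
    rfl
  have count : ∀ v, (T.filter fun w => π v - w ∈ T).card
      = Nat.card {k : Fin n × (ZMod 3)ˣ // v + weightOne k ∈ P} := by
    intro v
    rw [hT, Finset.filter_image, Finset.card_image_of_injective _ κinj, ← hT,
      Nat.card_eq_fintype_card, Fintype.card_subtype]
    refine Finset.card_nbij' (fun k => (k.1, -k.2)) (fun k => (k.1, -k.2)) ?_ ?_ ?_ ?_
    · intro k hk
      have hk := (Finset.mem_filter.mp hk).2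
      refine Finset.mem_filter.mpr ⟨Finset.mem_univ _, (hPT _).mpr ?_⟩
      rw [πadd]
      change π v + κ (k.1, -k.2) ∈ T
      rwa [κneg, ← sub_eq_add_neg]
    · intro k hk
      have hk := (hPT _).mp (Finset.mem_filter.mp hk).2
      refine Finset.mem_filter.mpr ⟨Finset.mem_univ _, ?_⟩
      rw [κneg, sub_neg_eq_add]
      exact hk
    · intro k _; simp
    · intro k _; simp
  refine false_of_partialDiffSet cardT negT (fun h => hCP 0 C.zero_mem ((hPT 0).mpr h))
    (fun v hv => ?_) fun v hv hv0 => ?_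
  · obtain ⟨v, rfl⟩ := Submodule.Quotient.mk_surjective C v
    rw [← hPP v ((hPT v).mpr hv)]
    exact count v
  · obtain ⟨v, rfl⟩ := Submodule.Quotient.mk_surjective C v
    rw [← hQP v (fun h => hv0 ((π0 v).mpr h)) fun h => hv ((hPT v).mp h)]
    exact count v

/-! ### Equitable partitions and their automorphisms -/

namespace IsEquitablePartition

variable {V : Type*} {G : SimpleGraph V} {r : ℕ} {P : Fin (r + 1) → Set V}
  {S : Matrix (Fin (r + 1)) (Fin (r + 1)) ℕ}

theorem eq_of_mem (h : IsEquitablePartition G P S) {v : V} {i j : Fin (r + 1)} (hi : v ∈ P i)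
    (hj : v ∈ P j) : i = j :=
  (h.existsUnique_cell v).unique hi hj

theorem disjoint (h : IsEquitablePartition G P S) {i j : Fin (r + 1)} (hij : i ≠ j) :
    Disjoint (P i) (P j) :=
  Set.disjoint_left.mpr fun _ hi hj => hij (h.eq_of_mem hi hj)

theorem ncard_inter_union (h : IsEquitablePartition G P S) {i j k : Fin (r + 1)} (hjk : j ≠ k)
    {v : V} (hv : v ∈ P i) : (G.neighborSet v ∩ (P j ∪ P k)).ncard = S i j + S i k := by
  rw [Set.inter_union_distrib_left, Set.ncard_union_eq
    ((h.disjoint hjk).mono Set.inter_subset_right Set.inter_subset_right)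
    (h.finite_inter v j) (h.finite_inter v k), h.ncard_inter i j v hv, h.ncard_inter i k v hv]

theorem sum_row [Finite V] (h : IsEquitablePartition G P S) {i : Fin (r + 1)} {v : V}
    (hv : v ∈ P i) : ∑ j, S i j = (G.neighborSet v).ncard := by
  classical
  have : Fintype V := Fintype.ofFinite V
  choose c hc hu using h.existsUnique_cell
  rw [Set.ncard_eq_toFinset_card', Finset.card_eq_sum_card_fiberwise (f := c) (t := Finset.univ)
    fun _ _ => Finset.mem_coe.mpr (Finset.mem_univ _)]
  refine Finset.sum_congr rfl fun j _ => ?_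
  rw [← h.ncard_inter i j v hv, Set.ncard_eq_toFinset_card']
  congr 1
  ext w
  simp only [Set.mem_toFinset, Set.mem_inter_iff, Finset.mem_filter]
  exact and_congr_right fun _ => ⟨fun hw => (hu w j hw).symm, fun hw => hw ▸ hc w⟩

theorem ncard_mul [Finite V] (h : IsEquitablePartition G P S) (i j : Fin (r + 1)) :
    (P i).ncard * S i j = (P j).ncard * S j i := by
  classical
  have : Fintype V := Fintype.ofFinite V
  have key := Finset.sum_card_bipartiteAbove_eq_sum_card_bipartiteBelow G.Adj
    (s := (P i).toFinset) (t := (P j).toFinset)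
  have e1 : ∀ v ∈ (P i).toFinset, ((P j).toFinset.bipartiteAbove G.Adj v).card = S i j := by
    intro v hv
    rw [← h.ncard_inter i j v (Set.mem_toFinset.mp hv), Set.ncard_eq_toFinset_card']
    congr 1
    ext w
    simp [Finset.bipartiteAbove, and_comm]
  have e2 : ∀ v ∈ (P j).toFinset, ((P i).toFinset.bipartiteBelow G.Adj v).card = S j i := by
    intro v hv
    rw [← h.ncard_inter j i v (Set.mem_toFinset.mp hv), Set.ncard_eq_toFinset_card']
    congr 1
    ext w
    simp [Finset.bipartiteBelow, and_comm, G.adj_comm]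
  rw [Finset.sum_congr rfl e1, Finset.sum_congr rfl e2] at key
  simpa [Set.ncard_eq_toFinset_card'] using key

/-- An automorphism that preserves the first cell preserves all the cells, if the intersection
matrix is tridiagonal with positive entries below the diagonal. -/
theorem map_mem (h : IsEquitablePartition G P S)
    (htri : ∀ i j : Fin (r + 1), (i : ℕ) + 1 < j ∨ (j : ℕ) + 1 < i → S i j = 0)
    (hpos : ∀ i : Fin r, S i.succ i.castSucc ≠ 0) (k : ℕ) :
    ∀ (σ : G ≃g G), (∀ v, σ v ∈ P 0 ↔ v ∈ P 0) → ∀ i : Fin (r + 1), (i : ℕ) = k →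
      ∀ v ∈ P i, σ v ∈ P i := by
  induction k using Nat.strong_induction_on with
  | _ k ih =>
    intro σ hσ i hik v hv
    rcases Fin.eq_zero_or_eq_succ i with rfl | ⟨j, rfl⟩
    · exact (hσ v).mpr hv
    · have hne : (G.neighborSet v ∩ P j.castSucc).Nonempty := by
        rw [Set.nonempty_iff_ne_empty]
        intro he
        refine hpos j ?_
        rw [← h.ncard_inter _ _ v hv, he, Set.ncard_empty]
      obtain ⟨w, hvw, hw⟩ := hne
      simp only [Fin.val_succ] at hik
      have hσw : σ w ∈ P j.castSucc := ih j (by omega) σ hσ _ rfl w hw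
      -- Being adjacent to `σ w`, the vertex `σ v` lies in a cell of index at most k. If the index
      -- were smaller, the induction hypothesis for the inverse of `σ` would put v in that cell too;
      -- hence the induction covers all automorphisms at once.
      obtain ⟨l, hl, -⟩ := h.existsUnique_cell (σ v)
      have hlj : S l j.castSucc ≠ 0 := by
        rw [← h.ncard_inter l _ _ hl]
        exact (Set.ncard_pos (h.finite_inter _ _)).mpr
          ⟨σ w, σ.map_adj_iff.mpr hvw, hσw⟩ |>.ne'
      have hle : k ≤ l := by
        by_contra hlt
        have hσ' : ∀ v, σ.symm v ∈ P 0 ↔ v ∈ P 0 := fun v => by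
          rw [← hσ (σ.symm v), RelIso.apply_symm_apply]
        have := ih l (not_le.mp hlt) σ.symm hσ' l rfl _ hl
        rw [RelIso.symm_apply_apply] at this
        have := h.eq_of_mem this hv
        rw [this, Fin.val_succ] at hlt
        omega
      have hge : (l : ℕ) ≤ k := by
        by_contra hlt
        refine hlj (htri l _ (Or.inr ?_))
        simp only [Fin.val_castSucc]
        omega
      have : l = j.succ := Fin.ext (by rw [Fin.val_succ]; omega)
      rwa [← this]

end IsEquitablePartition

/-! ### The two intersection arrays -/

theorem false_of_array_two {n : ℕ} (hn : n = 70) (C : Submodule (ZMod 3) (Fin n → ZMod 3))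
    (h : IsCompletelyRegularCode (hammingGraph n (ZMod 3)) (C : Set (Fin n → ZMod 3))
      ![140, 126] ![1, 30]) : False := by
  obtain ⟨P, S, hPC, hP, htri, hb, hc⟩ := h
  have hrow : ∀ i, ∑ j, S i j = 140 := fun i => by
    obtain ⟨v, hv⟩ := hP.nonempty i
    rw [hP.sum_row hv, ncard_neighborSet, hn]
  have b0 : S 0 1 = 140 := hb 0
  have b1 : S 1 2 = 126 := hb 1
  have c1 : S 1 0 = 1 := hc 0
  have c2 : S 2 1 = 30 := hc 1
  have t02 : S 2 0 = 0 := htri 2 0 (Or.inr (by decide))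
  have r0 := hrow 0
  have r1 := hrow 1
  simp only [Fin.sum_univ_succ, Fin.sum_univ_zero] at r0 r1
  change S 0 0 + (S 0 1 + (S 0 2 + 0)) = 140 at r0
  change S 1 0 + (S 1 1 + (S 1 2 + 0)) = 140 at r1
  have hcell : ∀ v, v ∈ P 0 ∨ v ∈ P 1 ∨ v ∈ P 2 := by
    intro v
    obtain ⟨i, hi, -⟩ := hP.existsUnique_cell v
    match i, hi with
    | 0, hi => exact Or.inl hi
    | 1, hi => exact Or.inr (Or.inl hi)
    | 2, hi => exact Or.inr (Or.inr hi)
  have hmem : ∀ v, v ∈ C ↔ v ∈ P 0 := fun v => by rw [hPC]; rfl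
  refine false_of_neighbor_counts hn C (P 1) (fun v hv hv1 => ?_) ?_ ?_ ?_ ?_
  · exact absurd (hP.eq_of_mem ((hmem v).mp hv) hv1) (by decide)
  · intro v hv
    rw [← hPC]
    rcases hcell v with h | h | h
    · rw [hP.ncard_inter 0 0 v h]; omega
    · exact absurd h hv
    · rw [hP.ncard_inter 2 0 v h, t02]
  · intro v hv
    rw [← hPC, hP.ncard_inter 1 0 v hv, c1]
  · intro v hv
    rw [hP.ncard_inter 1 1 v hv]; omega
  · intro v hvC hv
    rcases hcell v with h | h | h
    · exact absurd ((hmem v).mpr h) hvC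
    · exact absurd h hv
    · rw [hP.ncard_inter 2 1 v h, c2]

/-- A set that is closed under negation and under translation by the members of a submodule, that
has twice the size of the submodule and is disjoint from it, forms a submodule with it. -/
theorem exists_submodule_union {W : Type*} [AddCommGroup W] [Module (ZMod 3) W] [Finite W]
    (C : Submodule (ZMod 3) W) (Q : Set W) (hcard : Q.ncard = 2 * (C : Set W).ncard)
    (hdisj : ∀ v ∈ C, v ∉ Q) (hneg : ∀ v ∈ Q, -v ∈ Q) (hadd : ∀ c ∈ C, ∀ v ∈ Q, v + c ∈ Q) :
    ∃ C' : Submodule (ZMod 3) W, (C' : Set W) = (C : Set W) ∪ Q := by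
  have hCpos : 0 < (C : Set W).ncard := (Set.ncard_pos (Set.toFinite _)).mpr ⟨0, C.zero_mem⟩
  obtain ⟨a, ha⟩ : Q.Nonempty := (Set.ncard_pos (Set.toFinite _)).mp (by omega)
  have h3 : ∀ v : W, v + v = -v := fun v => by
    rw [← two_smul (ZMod 3), ZMod.two_eq_neg_one_three, neg_one_smul]
  -- The cosets a + C and -a + C lie in `Q` and are disjoint, since a - (-a) = -a is not in `C`; by
  -- cardinality they fill `Q`.
  have hQ : Q = (fun c => a + c) '' (C : Set W) ∪ (fun c => -a + c) '' (C : Set W) := by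
    symm
    refine Set.eq_of_subset_of_ncard_le ?_ ?_ (Set.toFinite _)
    · rintro v (⟨c, hc, rfl⟩ | ⟨c, hc, rfl⟩)
      · exact hadd c hc a ha
      · exact hadd c hc _ (hneg a ha)
    · rw [Set.ncard_union_eq _ (Set.toFinite _) (Set.toFinite _),
        Set.ncard_image_of_injective _ (add_right_injective a),
        Set.ncard_image_of_injective _ (add_right_injective (-a)), hcard, two_mul]
      rw [Set.disjoint_left]
      rintro v ⟨c, hc, rfl⟩ ⟨c', hc', h⟩
      refine hdisj (-a) ?_ (hneg a ha)
      have : -a = c' - c := by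
        rw [← h3]
        have h : -a + c' = a + c := h
        rw [eq_sub_iff_add_eq, add_assoc, ← h, add_neg_cancel_left]
      rw [this]
      exact C.sub_mem hc' hc
  have hmem : ∀ v, v ∈ C ⊔ Submodule.span (ZMod 3) {a} ↔ v ∈ (C : Set W) ∪ Q := by
    intro v
    rw [Submodule.mem_sup, hQ]
    constructor
    · rintro ⟨c, hc, w, hw, rfl⟩
      obtain ⟨t, rfl⟩ := Submodule.mem_span_singleton.mp hw
      rcases ZMod.three_cases t with rfl | rfl | rfl
      · left; simpa using hc
      · right; left; exact ⟨c, hc, by simp [add_comm]⟩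
      · right; right; exact ⟨c, hc, by simp [add_comm]⟩
    · have hs := Submodule.mem_span_singleton_self (R := ZMod 3) a
      rintro (hv | ⟨c, hc, rfl⟩ | ⟨c, hc, rfl⟩)
      · exact ⟨v, hv, 0, Submodule.zero_mem _, add_zero v⟩
      · exact ⟨c, hc, a, hs, add_comm _ _⟩
      · exact ⟨c, hc, -a, Submodule.neg_mem _ hs, add_comm _ _⟩
  exact ⟨C ⊔ Submodule.span (ZMod 3) {a}, Set.ext hmem⟩

/-- The coset graph would be an antipodal threefold cover, and adjoining `P 4` to the code folds it.
Cells 1 and 3 both have 13 neighbours within their union, and a vertex of cell 2 has 10 + 20 = 30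
neighbours there, as for the other array. -/
theorem false_of_array_four {n : ℕ} (hn : n = 70) (C : Submodule (ZMod 3) (Fin n → ZMod 3))
    (h : IsCompletelyRegularCode (hammingGraph n (ZMod 3)) (C : Set (Fin n → ZMod 3))
      ![140, 126, 20, 1] ![1, 10, 126, 140]) : False := by
  obtain ⟨P, S, hPC, hP, htri, hb, hc⟩ := h
  have hrow : ∀ i, ∑ j, S i j = 140 := fun i => by
    obtain ⟨v, hv⟩ := hP.nonempty i
    rw [hP.sum_row hv, ncard_neighborSet, hn]
  have b0 : S 0 1 = 140 := hb 0
  have b1 : S 1 2 = 126 := hb 1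
  have b2 : S 2 3 = 20 := hb 2
  have b3 : S 3 4 = 1 := hb 3
  have c1 : S 1 0 = 1 := hc 0
  have c2 : S 2 1 = 10 := hc 1
  have c3 : S 3 2 = 126 := hc 2
  have c4 : S 4 3 = 140 := hc 3
  have t04 : S 0 4 = 0 := htri 0 4 (Or.inl (by decide))
  have t13 : S 1 3 = 0 := htri 1 3 (Or.inl (by decide))
  have t14 : S 1 4 = 0 := htri 1 4 (Or.inl (by decide))
  have t20 : S 2 0 = 0 := htri 2 0 (Or.inr (by decide))
  have t24 : S 2 4 = 0 := htri 2 4 (Or.inl (by decide))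
  have t30 : S 3 0 = 0 := htri 3 0 (Or.inr (by decide))
  have t31 : S 3 1 = 0 := htri 3 1 (Or.inr (by decide))
  have t40 : S 4 0 = 0 := htri 4 0 (Or.inr (by decide))
  have r0 := hrow 0
  have r1 := hrow 1
  have r3 := hrow 3
  have r4 := hrow 4
  rw [Fin.sum_univ_five] at r0 r1 r3 r4
  have hcell : ∀ v, v ∈ P 0 ∨ v ∈ P 1 ∨ v ∈ P 2 ∨ v ∈ P 3 ∨ v ∈ P 4 := by
    intro v
    obtain ⟨i, hi, -⟩ := hP.existsUnique_cell v
    match i, hi with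
    | 0, hi => exact Or.inl hi
    | 1, hi => exact Or.inr (Or.inl hi)
    | 2, hi => exact Or.inr (Or.inr (Or.inl hi))
    | 3, hi => exact Or.inr (Or.inr (Or.inr (Or.inl hi)))
    | 4, hi => exact Or.inr (Or.inr (Or.inr (Or.inr hi)))
  have hmem : ∀ v, v ∈ C ↔ v ∈ P 0 := fun v => by rw [hPC]; rfl
  have hpos : ∀ i : Fin 4, S i.succ i.castSucc ≠ 0 := by
    intro i
    rw [hc i]
    revert i
    decide
  -- Counting edges between consecutive cells gives |P 4| = 2 · |C|. Negation and the translations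
  -- by `C` preserve `C`, hence also `P 4`.
  obtain ⟨C', hC'⟩ := exists_submodule_union C (P 4)
    (by
      have m0 := hP.ncard_mul 0 1
      have m1 := hP.ncard_mul 1 2
      have m2 := hP.ncard_mul 2 3
      have m3 := hP.ncard_mul 3 4
      rw [b0, c1] at m0
      rw [b1, c2] at m1
      rw [b2, c3] at m2
      rw [b3, c4] at m3
      rw [← hPC]
      omega)
    (fun v hv hv4 => absurd (hP.eq_of_mem ((hmem v).mp hv) hv4) (by decide))
    (hP.map_mem htri hpos 4 negIso (fun v => by
      rw [← hmem, ← hmem]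
      exact C.neg_mem_iff) 4 rfl)
    (fun c hc => hP.map_mem htri hpos 4 (translateIso c) (fun v => by
      rw [← hmem, ← hmem]
      exact C.add_mem_iff_left hc) 4 rfl)
  rw [← hPC] at hC'
  have hmem' : ∀ v, v ∈ C' ↔ v ∈ P 0 ∪ P 4 := fun v => by rw [← hC']; rfl
  have h04 : (0 : Fin 5) ≠ 4 := by decide
  have h13 : (1 : Fin 5) ≠ 3 := by decide
  refine false_of_neighbor_counts hn C' (P 1 ∪ P 3) (fun v hv hv1 => ?_) ?_ ?_ ?_ ?_
  · rcases (hmem' v).mp hv with h | h <;> rcases hv1 with h' | h' <;>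
      exact absurd (hP.eq_of_mem h h') (by decide)
  · intro v hv
    rw [hC']
    rcases hcell v with h | h | h | h | h
    · rw [hP.ncard_inter_union h04 h]; omega
    · exact absurd (Or.inl h) hv
    · rw [hP.ncard_inter_union h04 h]; omega
    · exact absurd (Or.inr h) hv
    · rw [hP.ncard_inter_union h04 h]; omega
  · rintro v (hv | hv)
    · rw [hC', hP.ncard_inter_union h04 hv]; omega
    · rw [hC', hP.ncard_inter_union h04 hv]; omega
  · rintro v (hv | hv)
    · rw [hP.ncard_inter_union h13 hv]; omega
    · rw [hP.ncard_inter_union h13 hv]; omega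
  · intro v hvC hv
    rw [hmem'] at hvC
    rcases hcell v with h | h | h | h | h
    · exact absurd (Or.inl h) hvC
    · exact absurd (Or.inl h) hv
    · rw [hP.ncard_inter_union h13 h]; omega
    · exact absurd (Or.inr h) hv
    · exact absurd (Or.inr h) hvC

theorem corollary7 :
    (¬ ∃ C : Submodule (ZMod 3) (Fin 70 → ZMod 3),
      IsCompletelyRegularCode (hammingGraph 70 (ZMod 3)) (C : Set (Fin 70 → ZMod 3))
        ![140, 126, 20, 1] ![1, 10, 126, 140]) ∧
    (¬ ∃ C : Submodule (ZMod 3) (Fin 70 → ZMod 3),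
      IsCompletelyRegularCode (hammingGraph 70 (ZMod 3)) (C : Set (Fin 70 → ZMod 3))
        ![140, 126] ![1, 30]) :=
  ⟨fun ⟨C, h⟩ => false_of_array_four rfl C h, fun ⟨C, h⟩ => false_of_array_two rfl C h⟩
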